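/- Let $p$ be a prime, let $\mathbb{K}$ be a field of characteristic $p$, and let $R=\bigoplus_{j\ge 0}R_j$ be a finitely generated commutative graded $\mathbb{K}$-algebra with $R_0=\mathbb{K}$ and homogeneous maximal ideal $\mathfrak m=\bigoplus_{j>0}R_j$. **Differential operators.** Let $D_R=D_{R|\mathbb{K}}=\bigcup_n D^n_{R|\mathbb K}$ be the ring of $\mathbb{K}$-linear (Grothendieck) differential operators on $R$: $D^0=\operatorname{Hom}_R(R,R)$, and a $\mathbb K$-linear map $\delta:R\to R$ lies in $D^{n+1}$ iff $\delta r-r\delta\in D^{n}$ for all $r\in R$. (If $\mathbb K$ is perfect, this is the ring of all $\mathbb F_p$-linear differential operators.) An operator $\delta$ is *of level $e$* if $\delta(r^{p^e}x)=r^{p^e}\delta(x)$ for all $r,x\in R$; every $\delta\in D_R$ is of some level. **Bernstein algebras.** Fix an integer $w>\max\{j : [\mathfrak m/\mathfrak m^2]_j\ne 0\}$. For $i\ge 0$ let $\mathcal B^i\subseteq D_R$ be the $\mathbb K$-span of the homogeneous operators $\delta$ with $\deg(\delta)+w\operatorname{ord}(\delta)\le i$. For a sequence $V^\bullet$ of $\mathbb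 K$-vector spaces put $$\operatorname{Dim}(V^\bullet)=\inf\Big\{s\in\mathbb R_{\ge0} : \lim_{i\to\infty}\frac{\dim_{\mathbb K}V^i}{i^s}=0\Big\},\qquad e(V^\bullet)=\limsup_{i\to\infty}\frac{\dim_{\mathbb K}V^i}{i^{\operatorname{Dim}(V^\bullet)}} .$$ $R$ is a *Bernstein algebra* if (i) there is an integer $C>0$ such that for all $i$ and all nonzero $\delta\in\mathcal B^i$ one has $1\in\mathcal B^{Ci}\,\delta\,\mathcal B^{Ci}$ (the $\mathbb K$-span of the products), (ii) $\operatorname{Dim}(\mathcal B^\bullet)=2\dim R$, and (iii) $0<e(\mathcal B^\bullet)<\infty$. **Holonomic modules.** A left $D_R$-module $M$ is *holonomic* if it is finitely generated and nonzero and has an ascending filtration by finite-dimensional $\mathbb K$-subspaces $\mathcal G^i$ ($i\ge0$) with $M=\bigcup_i\mathcal G^i$, $\mathcal B^i\mathcal G^j\subseteq\mathcal G^{i+j}$ for all $i,j$, $\operatorname{Dim}(\mathcal G^\bullet)=\dim R$ and $e(\mathcal G^\bullet)<\infty$. **The module $R_f\boldsymbol{f^\alpha}$.** For $f\in R$ and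 a $p$-adic integer $\alpha\in\mathbb Z_p$, $R_f\boldsymbol{f^\alpha}$ is the set of the $g\boldsymbol{f^\alpha}$ with $g\in R_f$, with $D_R$ acting by $\delta\cdot(g\boldsymbol{f^\alpha})=f^{-a}\,\delta(f^{a}g)\,\boldsymbol{f^\alpha}$, where $\delta$ is of level $e$, $a$ is any integer with $a\equiv\alpha \bmod p^e$, and $\delta$ is extended to $R_f$. **Theorem.** Suppose that $R$ is a Bernstein algebra. Then for every nonzero $f\in R$ and every $\alpha\in\mathbb Z_p$ the $D_R$-module $R_f\boldsymbol{f^\alpha}$ is holonomic, provided that $f$ is not nilpotent (that is, $R_f\neq0$; automatic if $R$ is reduced). In particular, for every nonzero $f$ and every $\alpha$, $R_f\boldsymbol{f^\alpha}$ has finite length as a $D_R$-module. -/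

import Mathlib

open scoped ENNReal NNReal Topology

/-! ## Grothendieck differential operators -/

section DiffOps

variable (K : Type*) [Field K] {R : Type*} [CommRing R] [Algebra K R]

/-- The commutator `δ r - r δ` of an endomorphism `δ` with the multiplication by `r`. -/
noncomputable def commMul (r : R) (δ : Module.End K R) : Module.End K R :=
  δ * LinearMap.mulLeft K r - LinearMap.mulLeft K r * δ

variable (R) in
/-- `diffOpOrd K R n` is `D^n_{R|K}`, the space of `K`-linear differential operators on `R` of
order at most `n`: those of order `0` are the `R`-linear maps, and `δ` has order at most `n + 1`
if `δ r - r δ` has order at most `n` for all `r`. -/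
noncomputable def diffOpOrd : ℕ → Submodule K (Module.End K R)
  | 0 =>
    { carrier := {δ | ∀ r x : R, δ (r * x) = r * δ x}
      add_mem' := fun ha hb r x => by simp [ha r x, hb r x, mul_add]
      zero_mem' := fun r x => by simp
      smul_mem' := fun c δ h r x => by simp [h r x] }
  | n + 1 =>
    { carrier := {δ | ∀ r : R, commMul K r δ ∈ diffOpOrd n}
      add_mem' := fun {a b} ha hb r => by
        have h : commMul K r (a + b) = commMul K r a + commMul K r b := by
          simp only [commMul, add_mul, mul_add]; abel
        rw [h]; exact add_mem (ha r) (hb r)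
      zero_mem' := fun r => by simp [commMul]
      smul_mem' := fun c δ h r => by
        have h' : commMul K r (c • δ) = c • commMul K r δ := by
          simp only [commMul, smul_mul_assoc, mul_smul_comm, smul_sub]
        rw [h']; exact Submodule.smul_mem _ c (h r) }

variable {K}

theorem mem_diffOpOrd_zero {δ : Module.End K R} :
    δ ∈ diffOpOrd K R 0 ↔ ∀ r x : R, δ (r * x) = r * δ x := Iff.rfl

theorem mem_diffOpOrd_succ {n : ℕ} {δ : Module.End K R} :
    δ ∈ diffOpOrd K R (n + 1) ↔ ∀ r : R, commMul K r δ ∈ diffOpOrd K R n := Iff.rfl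

theorem commMul_eq_zero {δ : Module.End K R} (h : δ ∈ diffOpOrd K R 0) (r : R) :
    commMul K r δ = 0 := by
  ext x
  simp [commMul, mem_diffOpOrd_zero.1 h r x]

theorem diffOpOrd_le_succ (n : ℕ) : diffOpOrd K R n ≤ diffOpOrd K R (n + 1) := by
  induction n with
  | zero => intro δ h r; rw [commMul_eq_zero h r]; exact zero_mem _
  | succ n ih => intro δ h r; exact ih (h r)

theorem diffOpOrd_mono {m n : ℕ} (h : m ≤ n) : diffOpOrd K R m ≤ diffOpOrd K R n :=
  monotone_nat_of_le_succ diffOpOrd_le_succ h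

theorem commMul_mul (r : R) (δ ε : Module.End K R) :
    commMul K r (δ * ε) = δ * commMul K r ε + commMul K r δ * ε := by
  simp only [commMul, mul_sub, sub_mul, mul_assoc]; abel

theorem mul_mem_diffOpOrd : ∀ (m n : ℕ) {δ ε : Module.End K R}, δ ∈ diffOpOrd K R m →
    ε ∈ diffOpOrd K R n → δ * ε ∈ diffOpOrd K R (m + n) := by
  intro m
  induction m with
  | zero =>
    intro n
    induction n with
    | zero =>
      intro δ ε hδ hε r x
      simp [mem_diffOpOrd_zero.1 hε r x, mem_diffOpOrd_zero.1 hδ r]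
    | succ n ih =>
      intro δ ε hδ hε r
      rw [commMul_mul, commMul_eq_zero hδ r, zero_mul, add_zero]
      exact ih hδ (hε r)
  | succ m ihm =>
    intro n
    induction n with
    | zero =>
      intro δ ε hδ hε r
      rw [commMul_mul, commMul_eq_zero hε r, mul_zero, zero_add]
      exact ihm 0 (hδ r) hε
    | succ n ihn =>
      intro δ ε hδ hε
      rw [← add_assoc, mem_diffOpOrd_succ]
      intro r
      rw [commMul_mul]
      refine add_mem (ihn hδ (hε r)) ?_
      have := ihm (n + 1) (hδ r) hε
      rwa [← add_assoc, add_right_comm] at this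

variable (K R) in
/-- The ring `D_{R|K}` of all `K`-linear differential operators on `R`. -/
noncomputable def diffOps : Subalgebra K (Module.End K R) where
  carrier := {δ | ∃ n, δ ∈ diffOpOrd K R n}
  mul_mem' := by
    rintro a b ⟨m, ha⟩ ⟨n, hb⟩
    exact ⟨m + n, mul_mem_diffOpOrd m n ha hb⟩
  add_mem' := by
    rintro a b ⟨m, ha⟩ ⟨n, hb⟩
    exact ⟨max m n, add_mem (diffOpOrd_mono (le_max_left m n) ha)
      (diffOpOrd_mono (le_max_right m n) hb)⟩
  algebraMap_mem' := fun c => ⟨0, fun r x => by simp [Module.algebraMap_end_apply]⟩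

variable (K R) in
/-- The ring `D_{R|K}` as a type. -/
def DiffOp : Type _ := ↥(diffOps K R)

noncomputable instance : Ring (DiffOp K R) := inferInstanceAs (Ring ↥(diffOps K R))

noncomputable instance : Algebra K (DiffOp K R) := inferInstanceAs (Algebra K ↥(diffOps K R))

/-- A differential operator as a `K`-linear map `R → R`. -/
noncomputable def DiffOp.toEnd : DiffOp K R →ₐ[K] Module.End K R := (diffOps K R).val

theorem DiffOp.toEnd_mem (δ : DiffOp K R) : δ.toEnd ∈ diffOps K R := Subtype.property δ

/-- `δ` is of level `e`, that is `δ` is linear over the subring of `p ^ e`-th powers. -/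
def HasLevel (p e : ℕ) (δ : Module.End K R) : Prop :=
  ∀ r x : R, δ (r ^ p ^ e * x) = r ^ p ^ e * δ x

theorem HasLevel.pow {p e : ℕ} {δ : Module.End K R} (h : HasLevel p e δ) (r x : R) (t : ℕ) :
    δ (r ^ (p ^ e * t) * x) = r ^ (p ^ e * t) * δ x := by
  rw [mul_comm (p ^ e) t, pow_mul]; exact h (r ^ t) x

theorem HasLevel.mono {p e e' : ℕ} {δ : Module.End K R} (h : HasLevel p e δ) (hle : e ≤ e') :
    HasLevel p e' δ := by
  intro r x
  obtain ⟨t, ht⟩ := pow_dvd_pow p hle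
  rw [ht]; exact h.pow r x t

/-- In characteristic `p`, an operator of order less than `p ^ e` has level `e`. -/
theorem hasLevel_of_mem_diffOpOrd (p : ℕ) [hp : Fact p.Prime] [CharP R p] {n e : ℕ}
    (hne : n < p ^ e) {δ : Module.End K R} (h : δ ∈ diffOpOrd K R n) : HasLevel p e δ := by
  have hR : Nontrivial R := CharP.nontrivial_of_char_ne_one (R := R) hp.out.ne_one
  have hK : CharP K p := (algebraMap K R).charP (algebraMap K R).injective p
  have hE : CharP (Module.End K (Module.End K R)) p :=
    charP_of_injective_algebraMap (algebraMap K (Module.End K (Module.End K R))).injective p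
  intro r x
  set L : Module.End K R := LinearMap.mulLeft K r with hL
  have hA : ∀ m : ℕ, ∀ ε ∈ diffOpOrd K R m,
      ((LinearMap.mulRight K L - LinearMap.mulLeft K L) ^ (m + 1)) ε = 0 := by
    intro m
    induction m with
    | zero => intro ε hε; simpa [commMul] using commMul_eq_zero hε r
    | succ m ih =>
      intro ε hε
      rw [pow_succ, Module.End.mul_apply]
      exact ih _ (by simpa [commMul] using hε r)
  have h0 : ((LinearMap.mulRight K L - LinearMap.mulLeft K L) ^ p ^ e) δ = 0 := by
    obtain ⟨k, hk⟩ := Nat.exists_eq_add_of_lt hne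
    rw [hk, show n + k + 1 = k + (n + 1) by ring, pow_add, Module.End.mul_apply, hA n δ h, map_zero]
  have hsub (A B : Module.End K (Module.End K R)) (h : Commute A B) :
      (A - B) ^ p ^ e = A ^ p ^ e - B ^ p ^ e := by
    have hr := sub_pow_char_pow_of_commute (R := Module.End K (Module.End K R)) p e h
    exact hr
  rw [hsub _ _ (LinearMap.commute_mulLeft_right (R := K) L L).symm] at h0
  have h1 := LinearMap.congr_fun h0 x
  have h2 : L ^ p ^ e = LinearMap.mulLeft K (r ^ p ^ e) := by simp [hL]
  simp [h2, sub_eq_zero] at h1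
  exact h1

theorem exists_hasLevel (p : ℕ) [hp : Fact p.Prime] [CharP R p] {δ : Module.End K R}
    (h : δ ∈ diffOps K R) : ∃ e, HasLevel p e δ := by
  obtain ⟨n, hn⟩ := h
  exact ⟨n, hasLevel_of_mem_diffOpOrd p (Nat.lt_pow_self hp.out.one_lt) hn⟩

end DiffOps

/-! ## The module `R_f f^α` -/

section RfAlpha

variable {K : Type*} [Field K] {R : Type*} [CommRing R] [Algebra K R]

open IsLocalization.Away in
/-- The fraction `r / f ^ N` in `R_f`. -/
noncomputable def awayFrac (f r : R) (N : ℕ) : Localization.Away f :=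
  algebraMap R (Localization.Away f) r * invSelf f ^ N

theorem algebraMap_pow_mul_invSelf_pow (f : R) (N : ℕ) :
    algebraMap R (Localization.Away f) f ^ N * IsLocalization.Away.invSelf f ^ N = 1 := by
  rw [← mul_pow, IsLocalization.Away.mul_invSelf, one_pow]

theorem awayFrac_add (f r s : R) (N : ℕ) :
    awayFrac f (r + s) N = awayFrac f r N + awayFrac f s N := by
  simp [awayFrac, add_mul]

theorem awayFrac_smul (c : K) (f r : R) (N : ℕ) :
    awayFrac f (c • r) N = c • awayFrac f r N := by
  simp [awayFrac, Algebra.smul_def, IsScalarTower.algebraMap_apply K R (Localization.Away f),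
    mul_assoc]

theorem awayFrac_pow_mul (f r : R) (N k : ℕ) :
    awayFrac f (f ^ k * r) (k + N) = awayFrac f r N := by
  have h := algebraMap_pow_mul_invSelf_pow f k
  simp only [awayFrac, map_mul, map_pow, pow_add]
  linear_combination (algebraMap R (Localization.Away f) r *
    IsLocalization.Away.invSelf f ^ N) * h

theorem awayFrac_eq_iff (f r s : R) (N : ℕ) :
    awayFrac f r N = awayFrac f s N ↔ ∃ k, f ^ k * r = f ^ k * s := by
  constructor
  · intro h
    have h1 : algebraMap R (Localization.Away f) r = algebraMap R (Localization.Away f) s := by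
      have hN := algebraMap_pow_mul_invSelf_pow f N
      simp only [awayFrac] at h
      linear_combination (algebraMap R (Localization.Away f) f ^ N) * h -
        (algebraMap R (Localization.Away f) r - algebraMap R (Localization.Away f) s) * hN
    exact IsLocalization.Away.exists_of_eq f h1
  · rintro ⟨k, hk⟩
    rw [← awayFrac_pow_mul f r N k, hk, awayFrac_pow_mul]

/-- Every element of `R_f` is a fraction with denominator `f ^ N` for all large `N`. -/
theorem exists_awayFrac (f : R) (g : Localization.Away f) :
    ∃ m : ℕ, ∀ N, m ≤ N → ∃ r, g = awayFrac f r N := by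
  obtain ⟨m, r, h⟩ := IsLocalization.Away.surj f g
  refine ⟨m, fun N hN => ⟨f ^ (N - m) * r, ?_⟩⟩
  have hg : g = awayFrac f r m := by
    rw [awayFrac, ← h, mul_assoc, algebraMap_pow_mul_invSelf_pow, mul_one]
  have h2 := awayFrac_pow_mul f r m (N - m)
  rw [Nat.sub_add_cancel hN] at h2
  rw [h2, hg]

variable {p : ℕ} [hp : Fact p.Prime]

theorem exists_large_approx (α : ℤ_[p]) (e m : ℕ) :
    ∃ N : ℕ, m ≤ N ∧ (p : ℤ_[p]) ^ e ∣ α - N := by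
  refine ⟨α.appr e + p ^ e * m, ?_, ?_⟩
  · exact (Nat.le_mul_of_pos_left m (pow_pos hp.out.pos e)).trans (Nat.le_add_left _ _)
  · have h := Ideal.mem_span_singleton.1 (PadicInt.appr_spec e α)
    have h2 := dvd_sub h (dvd_mul_right ((p : ℤ_[p]) ^ e) (m : ℤ_[p]))
    push_cast
    rwa [sub_sub] at h2

/-- Two natural numbers approximating the same `p`-adic integer differ by a multiple of `p ^ e`. -/
theorem exists_eq_add_of_approx {α : ℤ_[p]} {e N N' : ℕ} (h : (p : ℤ_[p]) ^ e ∣ α - N)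
    (h' : (p : ℤ_[p]) ^ e ∣ α - N') (hle : N ≤ N') : ∃ t, N' = p ^ e * t + N := by
  obtain ⟨d, rfl⟩ := Nat.exists_eq_add_of_le hle
  have h2 : (p : ℤ_[p]) ^ e ∣ ((d : ℤ) : ℤ_[p]) := by
    have := dvd_sub h h'
    push_cast at this ⊢
    simpa using this
  rw [PadicInt.pow_p_dvd_int_iff] at h2
  obtain ⟨t, ht⟩ : p ^ e ∣ d := by exact_mod_cast h2
  exact ⟨t, by rw [ht, add_comm]⟩

/-- The formula `δ · (g f^α) = f^{-N} δ(f^N g) f^α`, where `δ` has level `e` and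
`N ≡ α mod p ^ e`, for `N` so large that `f ^ N g = r` comes from `R`. -/
def TwistRel (f : R) (α : ℤ_[p]) (δ : Module.End K R) (g y : Localization.Away f) : Prop :=
  ∃ (e : ℕ) (r : R) (N : ℕ), HasLevel p e δ ∧ (p : ℤ_[p]) ^ e ∣ α - N ∧
    g = awayFrac f r N ∧ y = awayFrac f (δ r) N

theorem awayFrac_map_eq {f : R} {α : ℤ_[p]} {δ : Module.End K R} {e : ℕ} {r r' : R} {N N' : ℕ}
    (hδ : HasLevel p e δ) (h : (p : ℤ_[p]) ^ e ∣ α - N) (h' : (p : ℤ_[p]) ^ e ∣ α - N')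
    (hg : awayFrac f r N = awayFrac f r' N') :
    awayFrac f (δ r) N = awayFrac f (δ r') N' := by
  wlog hle : N ≤ N' generalizing N N' r r'
  · exact (this h' h hg.symm (le_of_not_ge hle)).symm
  obtain ⟨t, rfl⟩ := exists_eq_add_of_approx h h' hle
  rw [← awayFrac_pow_mul f r N (p ^ e * t), awayFrac_eq_iff] at hg
  rw [← awayFrac_pow_mul f (δ r) N (p ^ e * t), awayFrac_eq_iff]
  obtain ⟨k, hk⟩ := hg
  refine ⟨p ^ e * k, ?_⟩
  rw [← hδ.pow, ← hδ.pow, ← hδ.pow]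
  congr 1
  obtain ⟨j, hj⟩ := Nat.exists_eq_add_of_le (Nat.le_mul_of_pos_left k (pow_pos hp.out.pos e))
  rw [hj, add_comm, pow_add, mul_assoc, hk, mul_assoc]

theorem twistRel_unique {f : R} {α : ℤ_[p]} {δ : Module.End K R} {g y y' : Localization.Away f}
    (h : TwistRel f α δ g y) (h' : TwistRel f α δ g y') : y = y' := by
  obtain ⟨e, r, N, hδ, hN, hg, rfl⟩ := h
  obtain ⟨e', r', N', hδ', hN', hg', rfl⟩ := h'
  rcases le_total e e' with hle | hle
  · exact awayFrac_map_eq hδ hN ((pow_dvd_pow _ hle).trans hN') (hg.symm.trans hg')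
  · exact awayFrac_map_eq hδ' ((pow_dvd_pow _ hle).trans hN) hN' (hg.symm.trans hg')

theorem twistRel_exists {f : R} (α : ℤ_[p]) {δ : Module.End K R} (hδ : ∃ e, HasLevel p e δ)
    (g : Localization.Away f) : ∃ y, TwistRel f α δ g y := by
  obtain ⟨e, he⟩ := hδ
  obtain ⟨m, hm⟩ := exists_awayFrac f g
  obtain ⟨N, hmN, hN⟩ := exists_large_approx α e m
  obtain ⟨r, hr⟩ := hm N hmN
  exact ⟨_, e, r, N, he, hN, hr, rfl⟩

/-- The operator `f^{-α} δ f^α` on `R_f`, for an operator `δ` on `R` of some finite level. -/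
noncomputable def twist (f : R) (α : ℤ_[p]) (δ : Module.End K R) (hδ : ∃ e, HasLevel p e δ) :
    Module.End K (Localization.Away f) where
  toFun g := (twistRel_exists α hδ g).choose
  map_add' g g' := by
    obtain ⟨e, he⟩ := hδ
    obtain ⟨m, hm⟩ := exists_awayFrac f g
    obtain ⟨m', hm'⟩ := exists_awayFrac f g'
    obtain ⟨N, hmN, hN⟩ := exists_large_approx α e (max m m')
    obtain ⟨r, hr⟩ := hm N ((le_max_left _ _).trans hmN)
    obtain ⟨r', hr'⟩ := hm' N ((le_max_right _ _).trans hmN)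
    rw [twistRel_unique (twistRel_exists α ⟨e, he⟩ g).choose_spec ⟨e, r, N, he, hN, hr, rfl⟩,
      twistRel_unique (twistRel_exists α ⟨e, he⟩ g').choose_spec ⟨e, r', N, he, hN, hr', rfl⟩,
      ← awayFrac_add, ← map_add]
    refine twistRel_unique (twistRel_exists α ⟨e, he⟩ (g + g')).choose_spec
      ⟨e, r + r', N, he, hN, ?_, rfl⟩
    rw [hr, hr', awayFrac_add]
  map_smul' c g := by
    obtain ⟨e, r, N, he, hN, hr, hy⟩ := (twistRel_exists α hδ g).choose_spec
    rw [hy, RingHom.id_apply, ← awayFrac_smul, ← map_smul]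
    refine twistRel_unique (twistRel_exists α hδ (c • g)).choose_spec
      ⟨e, c • r, N, he, hN, ?_, rfl⟩
    rw [hr, awayFrac_smul]

theorem twist_eq {f : R} {α : ℤ_[p]} {δ : Module.End K R} (hδ : ∃ e, HasLevel p e δ)
    {g y : Localization.Away f} (h : TwistRel f α δ g y) : twist f α δ hδ g = y :=
  twistRel_unique (twistRel_exists α hδ g).choose_spec h

theorem twist_awayFrac {f : R} {α : ℤ_[p]} {δ : Module.End K R} {e N : ℕ} (he : HasLevel p e δ)
    (hN : (p : ℤ_[p]) ^ e ∣ α - N) (r : R) :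
    twist f α δ ⟨e, he⟩ (awayFrac f r N) = awayFrac f (δ r) N :=
  twist_eq _ ⟨e, r, N, he, hN, rfl, rfl⟩

/-- To prove an equation in `R_f` it is enough to check it on fractions with denominator `f ^ N`
where `N ≡ α mod p ^ e`. -/
theorem exists_awayFrac_approx (f : R) (α : ℤ_[p]) (e : ℕ) (g : Localization.Away f) :
    ∃ (r : R) (N : ℕ), (p : ℤ_[p]) ^ e ∣ α - N ∧ g = awayFrac f r N := by
  obtain ⟨m, hm⟩ := exists_awayFrac f g
  obtain ⟨N, hmN, hN⟩ := exists_large_approx α e m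
  obtain ⟨r, hr⟩ := hm N hmN
  exact ⟨r, N, hN, hr⟩

theorem twist_add {f : R} {α : ℤ_[p]} {δ ε : Module.End K R} (hδ : ∃ e, HasLevel p e δ)
    (hε : ∃ e, HasLevel p e ε) (h : ∃ e, HasLevel p e (δ + ε)) :
    twist f α (δ + ε) h = twist f α δ hδ + twist f α ε hε := by
  obtain ⟨e₁, h₁⟩ := hδ
  obtain ⟨e₂, h₂⟩ := hε
  have h₁' := h₁.mono (le_max_left e₁ e₂)
  have h₂' := h₂.mono (le_max_right e₁ e₂)
  refine LinearMap.ext fun g => ?_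
  obtain ⟨r, N, hN, rfl⟩ := exists_awayFrac_approx f α (max e₁ e₂) g
  rw [LinearMap.add_apply, twist_awayFrac h₁' hN, twist_awayFrac h₂' hN, ← awayFrac_add]
  refine twist_eq _ ⟨max e₁ e₂, r, N, fun a x => ?_, hN, rfl, rfl⟩
  simp [h₁' a x, h₂' a x, mul_add]

theorem twist_smul {f : R} {α : ℤ_[p]} {δ : Module.End K R} (c : K) (hδ : ∃ e, HasLevel p e δ)
    (h : ∃ e, HasLevel p e (c • δ)) : twist f α (c • δ) h = c • twist f α δ hδ := by
  obtain ⟨e, he⟩ := hδ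
  refine LinearMap.ext fun g => ?_
  obtain ⟨r, N, hN, rfl⟩ := exists_awayFrac_approx f α e g
  rw [LinearMap.smul_apply, twist_awayFrac he hN, ← awayFrac_smul]
  refine twist_eq _ ⟨e, r, N, fun a x => ?_, hN, rfl, rfl⟩
  simp [he a x]

theorem twist_one {f : R} {α : ℤ_[p]} (h : ∃ e, HasLevel p e (1 : Module.End K R)) :
    twist f α 1 h = 1 := by
  refine LinearMap.ext fun g => ?_
  obtain ⟨r, N, hN, rfl⟩ := exists_awayFrac_approx f α 0 g
  exact twist_eq _ ⟨0, r, N, fun a x => rfl, hN, rfl, rfl⟩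

theorem twist_mul {f : R} {α : ℤ_[p]} {δ ε : Module.End K R} (hδ : ∃ e, HasLevel p e δ)
    (hε : ∃ e, HasLevel p e ε) (h : ∃ e, HasLevel p e (δ * ε)) :
    twist f α (δ * ε) h = twist f α δ hδ * twist f α ε hε := by
  obtain ⟨e₁, h₁⟩ := hδ
  obtain ⟨e₂, h₂⟩ := hε
  have h₁' := h₁.mono (le_max_left e₁ e₂)
  have h₂' := h₂.mono (le_max_right e₁ e₂)
  refine LinearMap.ext fun g => ?_
  obtain ⟨r, N, hN, rfl⟩ := exists_awayFrac_approx f α (max e₁ e₂) g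
  rw [Module.End.mul_apply, twist_awayFrac h₂' hN, twist_awayFrac h₁' hN]
  refine twist_eq _ ⟨max e₁ e₂, r, N, fun a x => ?_, hN, rfl, rfl⟩
  rw [Module.End.mul_apply, Module.End.mul_apply, h₂' a x, h₁' a]

variable [CharP R p]

variable (K) in
/-- The ring homomorphism `Υ_{f,α}`, `δ ↦ f^{-α} δ f^α`, from `D_{R|K}` to the endomorphisms
of `R_f`. -/
noncomputable def upsilon (f : R) (α : ℤ_[p]) :
    DiffOp K R →ₐ[K] Module.End K (Localization.Away f) :=
  AlgHom.ofLinearMap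
    { toFun := fun δ => twist f α δ.toEnd (exists_hasLevel p δ.toEnd_mem)
      map_add' := fun δ ε => twist_add (exists_hasLevel p δ.toEnd_mem)
        (exists_hasLevel p ε.toEnd_mem) (exists_hasLevel p (DiffOp.toEnd_mem (δ + ε)))
      map_smul' := fun c δ => twist_smul c (exists_hasLevel p δ.toEnd_mem)
        (exists_hasLevel p (DiffOp.toEnd_mem (c • δ))) }
    (twist_one (exists_hasLevel p (one_mem (diffOps K R))))
    (fun δ ε => twist_mul (exists_hasLevel p δ.toEnd_mem) (exists_hasLevel p ε.toEnd_mem)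
      (exists_hasLevel p (DiffOp.toEnd_mem (δ * ε))))

/-- `Υ_{f,α}(δ)(r / f^N) = δ(r) / f^N` if `δ` has level `e` and `N ≡ α mod p ^ e`. -/
theorem upsilon_awayFrac (f : R) (α : ℤ_[p]) (δ : DiffOp K R) {e N : ℕ}
    (he : HasLevel p e δ.toEnd) (hN : (p : ℤ_[p]) ^ e ∣ α - N) (r : R) :
    upsilon K f α δ (awayFrac f r N) = awayFrac f (δ.toEnd r) N :=
  twist_awayFrac he hN r

/-- `Υ_{f,0}(δ)` is the extension of `δ` to `R_f`. -/
theorem upsilon_zero_algebraMap (f : R) (δ : DiffOp K R) (r : R) :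
    upsilon K f (0 : ℤ_[p]) δ (algebraMap R _ r) = algebraMap R _ (δ.toEnd r) := by
  obtain ⟨e, he⟩ := exists_hasLevel p δ.toEnd_mem
  have h := upsilon_awayFrac f (0 : ℤ_[p]) δ he (N := 0) (by simp) r
  simpa [awayFrac] using h

/-- `Υ_{f,α}(δ) g = f^{-a} δ(f^a g)` if `δ` has level `e` and `a ≡ α mod p ^ e`, where on the
right-hand side `δ` stands for its extension `Υ_{f,0}(δ)` to `R_f`. -/
theorem upsilon_eq_conj (f : R) (α : ℤ_[p]) (δ : DiffOp K R) {e a : ℕ}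
    (he : HasLevel p e δ.toEnd) (ha : (p : ℤ_[p]) ^ e ∣ α - a) (g : Localization.Away f) :
    upsilon K f α δ g = IsLocalization.Away.invSelf f ^ a *
      upsilon K f (0 : ℤ_[p]) δ (algebraMap R _ f ^ a * g) := by
  obtain ⟨r, N, hN, hr⟩ := exists_awayFrac_approx f (0 : ℤ_[p]) e
    (algebraMap R (Localization.Away f) f ^ a * g)
  have h1 := algebraMap_pow_mul_invSelf_pow f a
  have hg : g = awayFrac f r (a + N) := by
    simp only [awayFrac, pow_add] at hr ⊢
    linear_combination (IsLocalization.Away.invSelf f ^ a) * hr - g * h1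
  have hN' : (p : ℤ_[p]) ^ e ∣ α - ((a + N : ℕ) : ℤ_[p]) := by
    have := dvd_add ha hN
    push_cast
    rwa [show α - a + (0 - (N : ℤ_[p])) = α - (a + N) by ring] at this
  rw [hr, upsilon_awayFrac f 0 δ he hN, hg, upsilon_awayFrac f α δ he hN']
  simp only [awayFrac, pow_add]
  ring

/-- The `D_{R|K}`-module `R_f f^α`: its elements `g f^α` are given by the elements `g` of `R_f`,
and `δ` acts by `δ · (g f^α) = Υ_{f,α}(δ)(g) f^α`. -/
def RfAlpha (f : R) (_α : ℤ_[p]) : Type _ := Localization.Away f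

noncomputable instance (f : R) (α : ℤ_[p]) : AddCommGroup (RfAlpha f α) :=
  inferInstanceAs (AddCommGroup (Localization.Away f))

noncomputable instance (f : R) (α : ℤ_[p]) : Module K (RfAlpha f α) :=
  inferInstanceAs (Module K (Localization.Away f))

noncomputable instance (f : R) (α : ℤ_[p]) : Module (DiffOp K R) (RfAlpha f α) :=
  Module.compHom (Localization.Away f) (upsilon K f α).toRingHom

theorem RfAlpha.smul_def (f : R) (α : ℤ_[p]) (δ : DiffOp K R) (g : RfAlpha f α) :
    δ • g = (upsilon K f α δ : Module.End K (Localization.Away f)) g := rfl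

instance (f : R) (α : ℤ_[p]) : IsScalarTower K (DiffOp K R) (RfAlpha f α) where
  smul_assoc c δ g := by
    rw [RfAlpha.smul_def, RfAlpha.smul_def, map_smul]; rfl

end RfAlpha

/-! ## Bernstein algebras and holonomic modules -/

section Growth

/-- The dimension of a `K`-vector space, as an element of `[0, ∞]`. -/
noncomputable def vdim (K : Type*) [Field K] (V : Type*) [AddCommGroup V] [Module K V] : ℝ≥0∞ :=
  ((Module.rank K V).toENat : ℝ≥0∞)

/-- The growth exponent `inf {s ≥ 0 | lim h(i) / i^s = 0}` of a sequence, in `[0, ∞]`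
(it is `∞` if there is no such `s`). -/
noncomputable def growthDim (h : ℕ → ℝ≥0∞) : ℝ≥0∞ :=
  ⨅ (s : ℝ≥0) (_ : Filter.Tendsto (fun i : ℕ => h i / (i : ℝ≥0∞) ^ (s : ℝ)) Filter.atTop (𝓝 0)),
    (s : ℝ≥0∞)

/-- The multiplicity `limsup h(i) / i^d`, where `d` is the growth exponent of `h`. -/
noncomputable def growthMult (h : ℕ → ℝ≥0∞) : ℝ≥0∞ :=
  Filter.limsup (fun i : ℕ => h i / (i : ℝ≥0∞) ^ (growthDim h).toReal) Filter.atTop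

end Growth

section Bernstein

variable {K : Type*} [Field K] {R : Type*} [CommRing R] [Algebra K R]
variable (𝒜 : ℕ → Submodule K R)

/-- `δ` is homogeneous of degree `d ∈ ℤ`, that is `δ(R_j) ⊆ R_{j+d}` for all `j`,
where `R_k = 0` for `k < 0`. -/
def IsHomogeneousOp (d : ℤ) (δ : Module.End K R) : Prop :=
  ∀ j : ℕ, ∀ x ∈ 𝒜 j, (∀ k : ℕ, (k : ℤ) = j + d → δ x ∈ 𝒜 k) ∧ ((j : ℤ) + d < 0 → δ x = 0)

/-- The `i`-th piece of the Bernstein filtration of slope `w`: the span of the homogeneous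
operators `δ` with `deg δ + w ord δ ≤ i`. -/
noncomputable def bernsteinFil (w i : ℕ) : Submodule K (DiffOp K R) :=
  Submodule.span K {δ | ∃ (d : ℤ) (n : ℕ), IsHomogeneousOp 𝒜 d δ.toEnd ∧ δ.toEnd ∈ diffOpOrd K R n ∧
    d + w * n ≤ i}

/-- `[𝔪 / 𝔪²]_j ≠ 0`, where `𝔪` is the ideal of elements without constant term. -/
def IsGeneratorDegree [GradedAlgebra 𝒜] (j : ℕ) : Prop :=
  ∃ x ∈ 𝒜 j, x ∈ (HomogeneousIdeal.irrelevant 𝒜).toIdeal ∧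
    x ∉ (HomogeneousIdeal.irrelevant 𝒜).toIdeal ^ 2

/-- `R` is a Bernstein algebra with respect to its Bernstein filtration `ℬ` of slope `w`. -/
structure IsBernsteinAlgebra (w : ℕ) : Prop where
  linearly_simple : ∃ C : ℕ, 0 < C ∧ ∀ i : ℕ, ∀ δ ∈ bernsteinFil 𝒜 w i, δ ≠ 0 →
    1 ∈ bernsteinFil 𝒜 w (C * i) * Submodule.span K {δ} * bernsteinFil 𝒜 w (C * i)
  dim_eq : ∃ d : ℕ, ringKrullDim R = d ∧
    growthDim (fun i => vdim K (bernsteinFil 𝒜 w i)) = 2 * d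
  mult_pos : 0 < growthMult (fun i => vdim K (bernsteinFil 𝒜 w i))
  mult_lt_top : growthMult (fun i => vdim K (bernsteinFil 𝒜 w i)) < ⊤

variable (M : Type*) [AddCommGroup M] [Module K M] [Module (DiffOp K R) M]

variable {M} in
/-- `G` is a `ℬ`-filtration of the `D_{R|K}`-module `M`. -/
structure IsBernsteinModuleFil (w : ℕ) (G : ℕ → Submodule K M) : Prop where
  mono : Monotone G
  finite : ∀ i, FiniteDimensional K (G i)
  exhaustive : ∀ m : M, ∃ i, m ∈ G i
  smul_mem : ∀ i j : ℕ, ∀ δ ∈ bernsteinFil 𝒜 w i, ∀ m ∈ G j, δ • m ∈ G (i + j)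

/-- `M` is a holonomic `D_{R|K}`-module: it is finitely generated and nonzero, and it has a
`ℬ`-filtration of dimension `dim R` and finite multiplicity. -/
structure IsHolonomic [IsScalarTower K (DiffOp K R) M] (w : ℕ) : Prop where
  finite : Module.Finite (DiffOp K R) M
  nontrivial : Nontrivial M
  exists_fil : ∃ G : ℕ → Submodule K M, IsBernsteinModuleFil 𝒜 w G ∧
    (∃ d : ℕ, ringKrullDim R = d ∧ growthDim (fun i => vdim K (G i)) = d) ∧
    growthMult (fun i => vdim K (G i)) < ⊤

end Bernstein

/-! ## Growth of sequences -/

section GrowthBounds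

open Filter

/-! Write `d` for the Krull dimension of `R`, let `f` have degree at most `F`, and filter `R_f f^α`
by `G^i = f^{-i} R_{≤ (F+1)i} f^α`. The theorem comes from an upper bound on this filtration and a
lower bound on all filtrations.

The filtration is compatible with `ℬ`. A nonzero homogeneous operator of order `n` lowers degrees by
at most `n (w - 1)` (for `w > 0`), so elements of `ℬ^i` have order at most `i` and raise degrees by
at most `i`. An operator of order `n` maps `f^{n+b} R` into `f^b R`. Hence, with a large `N`
approximating `α`, the surplus powers of `f` cancel and the pole order grows by at most `i`,
whatever `α` is (`exists_map_pow_mul_eq`, `smul_mem_poleFil`).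

Upper bound: `dim G^i` is at most `dim R_{≤ (F+1)i}`, which is `O(i^d)` by Noether normalization
(`exists_finrank_degreeLE_le`).

Lower bound: condition (i) gives Bernstein's inequality `dim ℬ^i ≤ (dim H^{(C+1)i+j})^2` for a
filtered module with `H^j ≠ 0` (`vdim_bernsteinFil_le`). Since `dim ℬ^i` infinitely often exceeds a
multiple of `i^{2d}`, every nonzero subquotient contributes at least `c k^d` for infinitely many
`k`, with `c` independent of the subquotient. Contributions add up along a chain of submodules, so
comparison with the upper bound limits the length of chains. Finite length follows, hence finite
generation, and the chain `⊥ < ⊤` shows that the growth exponent is exactly `d`. -/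

theorem growthDim_le_of_le_pow {h : ℕ → ℝ≥0∞} {d : ℕ} {A : ℝ≥0∞} (hA : A ≠ ⊤)
    (hup : ∀ᶠ k : ℕ in atTop, h k ≤ A * (k : ℝ≥0∞) ^ d) : growthDim h ≤ d := by
  refine le_of_forall_gt_imp_ge_of_dense fun a ha => ?_
  obtain ⟨s, hs, hsa⟩ := ENNReal.lt_iff_exists_nnreal_btwn.1 ha
  refine le_trans (iInf₂_le s ?_) hsa.le
  have hds : (d : ℝ) < s := by exact_mod_cast hs
  -- For every `s > d`, the quotient by `k^s` is dominated by `A k^{d-s}`, which tends to 0.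
  have h1 : Tendsto (fun k : ℕ => A * ((k : ℝ≥0∞) ^ ((s : ℝ) - d))⁻¹) atTop (𝓝 0) := by
    have h2 : Tendsto (fun k : ℕ => ((k : ℝ≥0∞) ^ ((s : ℝ) - d))) atTop (𝓝 ⊤) :=
      (ENNReal.tendsto_rpow_at_top (sub_pos.2 hds)).comp ENNReal.tendsto_nat_nhds_top
    have h3 := ENNReal.Tendsto.const_mul (a := A) (tendsto_inv_iff.2 h2) (Or.inr hA)
    simpa using h3
  refine tendsto_of_tendsto_of_tendsto_of_le_of_le' tendsto_const_nhds h1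
    (Eventually.of_forall fun _ => zero_le) ?_
  filter_upwards [hup, eventually_ge_atTop 1] with k hk hk1
  have hk0 : (k : ℝ≥0∞) ≠ 0 := by exact_mod_cast (by omega : k ≠ 0)
  have hkt : (k : ℝ≥0∞) ≠ ⊤ := ENNReal.natCast_ne_top k
  rw [← ENNReal.rpow_neg, neg_sub, ENNReal.rpow_sub _ _ hk0 hkt, ENNReal.rpow_natCast,
    ← mul_div_assoc]
  exact ENNReal.div_le_div_right hk _

/-- Infinitely many indices suffice: for `s < d`, convergence of `h k / k^s` to 0 would eventually
force `h k < c k^s ≤ c k^d`. A positive limsup provides no more than infinitely many indices. -/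
theorem le_growthDim_of_frequently {h : ℕ → ℝ≥0∞} {d : ℕ} {c : ℝ≥0∞} (hc : c ≠ 0)
    (hlow : ∃ᶠ k : ℕ in atTop, c * (k : ℝ≥0∞) ^ d ≤ h k) : (d : ℝ≥0∞) ≤ growthDim h := by
  refine le_iInf₂ fun s hs => ?_
  by_contra hlt
  have hsd : (s : ℝ) < d := by exact_mod_cast not_le.1 hlt
  have hev : ∀ᶠ k : ℕ in atTop, h k / (k : ℝ≥0∞) ^ (s : ℝ) < c :=
    hs.eventually_lt_const (pos_iff_ne_zero.2 hc)
  obtain ⟨k, hk, hk', hk1⟩ := (hlow.and_eventually (hev.and (eventually_ge_atTop 1))).exists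
  have hk0 : (k : ℝ≥0∞) ≠ 0 := by exact_mod_cast (by omega : k ≠ 0)
  have hkt : (k : ℝ≥0∞) ≠ ⊤ := ENNReal.natCast_ne_top k
  refine absurd hk' (not_lt.2 ?_)
  rw [ENNReal.le_div_iff_mul_le (Or.inl (by simp [hk0])) (Or.inl (by simp [hk0, hkt]))]
  refine le_trans ?_ hk
  rw [← ENNReal.rpow_natCast]
  gcongr
  exact_mod_cast hk1

theorem growthMult_lt_top_of_le_pow {h : ℕ → ℝ≥0∞} {d : ℕ} {A : ℝ≥0∞} (hA : A ≠ ⊤)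
    (hd : growthDim h = d) (hup : ∀ᶠ k : ℕ in atTop, h k ≤ A * (k : ℝ≥0∞) ^ d) :
    growthMult h < ⊤ := by
  refine lt_of_le_of_lt (limsup_le_of_le (by isBoundedDefault) ?_) hA.lt_top
  filter_upwards [hup, eventually_ge_atTop 1] with k hk hk1
  have hk0 : (k : ℝ≥0∞) ≠ 0 := by exact_mod_cast (by omega : k ≠ 0)
  rw [hd, ENNReal.toReal_natCast, ENNReal.rpow_natCast]
  exact ENNReal.div_le_of_le_mul hk

/-- A sequence of positive multiplicity infinitely often exceeds a multiple of the power of the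
index given by its growth exponent. -/
theorem frequently_of_growthMult_pos {h : ℕ → ℝ≥0∞} {d : ℕ} (hd : growthDim h = 2 * d)
    (hpos : 0 < growthMult h) :
    ∃ c : ℝ≥0∞, c ≠ 0 ∧ ∃ᶠ k : ℕ in atTop, (c * (k : ℝ≥0∞) ^ d) ^ 2 ≤ h k := by
  obtain ⟨c, hc, hc'⟩ := exists_between hpos
  have hfr := frequently_lt_of_lt_limsup (by isBoundedDefault) hc'
  -- The cap at 1 ensures `(min c 1)^2 ≤ c`. The bound is put as a square to match Bernstein's
  -- inequality.
  refine ⟨min c 1, by simp [hc.ne'], (hfr.and_eventually (eventually_ge_atTop 1)).mono ?_⟩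
  rintro k ⟨hk, hk1⟩
  have hk0 : (k : ℝ≥0∞) ≠ 0 := by exact_mod_cast (by omega : k ≠ 0)
  have hkt : (k : ℝ≥0∞) ≠ ⊤ := ENNReal.natCast_ne_top k
  have h2 : ((2 * d : ℝ≥0∞)).toReal = ((2 * d : ℕ) : ℝ) := by simp
  rw [hd, h2, ENNReal.rpow_natCast, ENNReal.lt_div_iff_mul_lt (Or.inl (by simp [hk0]))
    (Or.inl (by simp [hkt]))] at hk
  refine le_trans ?_ hk.le
  rw [mul_pow, ← pow_mul, mul_comm d 2]
  gcongr
  calc (min c 1) ^ 2 = min c 1 * min c 1 := sq _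
    _ ≤ c * 1 := by gcongr <;> simp
    _ = c := mul_one c

end GrowthBounds

/-! ## Bernstein's inequality and finite length -/

section BernsteinInequality

variable {K : Type*} [Field K]

theorem vdim_eq_finrank (V : Type*) [AddCommGroup V] [Module K V] [FiniteDimensional K V] :
    vdim K V = Module.finrank K V := by
  rw [vdim, ← Module.finrank_eq_rank, Cardinal.toENat_nat, ENat.toENNReal_coe]

theorem vdim_le_of_injective {V W : Type*} [AddCommGroup V] [Module K V] [AddCommGroup W]
    [Module K W] [FiniteDimensional K W] (g : V →ₗ[K] W) (hg : Function.Injective g) :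
    vdim K V ≤ Module.finrank K W := by
  have : FiniteDimensional K V := FiniteDimensional.of_injective g hg
  rw [vdim_eq_finrank]
  exact_mod_cast LinearMap.finrank_le_finrank_of_injective hg

variable {R : Type*} [CommRing R] [Algebra K R] (𝒜 : ℕ → Submodule K R)
variable {M : Type*} [AddCommGroup M] [Module K M] [Module (DiffOp K R) M]
  [IsScalarTower K (DiffOp K R) M]

/-- Bernstein's inequality for one step of the filtration. -/
theorem vdim_bernsteinFil_le {w C i j : ℕ} {H : ℕ → Submodule K M} (hmono : Monotone H)
    (hfin : ∀ i, FiniteDimensional K (H i))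
    (hsmul : ∀ i j : ℕ, ∀ δ ∈ bernsteinFil 𝒜 w i, ∀ m ∈ H j, δ • m ∈ H (i + j))
    (hC : ∀ δ ∈ bernsteinFil 𝒜 w i, δ ≠ 0 →
      1 ∈ bernsteinFil 𝒜 w (C * i) * Submodule.span K {δ} * bernsteinFil 𝒜 w (C * i))
    (hne : H j ≠ ⊥) :
    vdim K (bernsteinFil 𝒜 w i) ≤ (Module.finrank K (H ((C + 1) * i + j)) : ℝ≥0∞) ^ 2 := by
  have hk : (C + 1) * i + j = i + (C * i + j) := by ring
  rw [hk]
  set a := C * i + j with ha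
  -- Each `δ` is recorded by its action `H a → H (i + a)`. If a nonzero `δ` killed `H a`, then,
  -- since `ℬ^{Ci}` carries `H j` into `H a`, all of `ℬ^{Ci} δ ℬ^{Ci}` would kill `H j`; but it
  -- contains 1.
  let g : bernsteinFil 𝒜 w i →ₗ[K] (H a →ₗ[K] H (i + a)) :=
    { toFun := fun δ => LinearMap.restrict (Algebra.lsmul K K M δ.1) (hsmul i a δ.1 δ.2)
      map_add' := fun δ ε => LinearMap.ext fun m => Subtype.ext (add_smul δ.1 ε.1 m.1)
      map_smul' := fun c δ => LinearMap.ext fun m => Subtype.ext (smul_assoc c δ.1 m.1) }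
  have hg : Function.Injective g := by
    rw [← LinearMap.ker_eq_bot, LinearMap.ker_eq_bot']
    rintro ⟨δ, hδ⟩ h0
    by_contra hne0
    have hδ0 : δ ≠ 0 := fun h => hne0 (by simp [h])
    have hkill : ∀ m ∈ H a, δ • m = 0 := fun m hm =>
      congrArg Subtype.val (LinearMap.congr_fun h0 ⟨m, hm⟩)
    obtain ⟨m, hm, hm0⟩ := Submodule.exists_mem_ne_zero_of_ne_bot hne
    have hall : ∀ τ ∈ bernsteinFil 𝒜 w (C * i) * Submodule.span K {δ} * bernsteinFil 𝒜 w (C * i),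
        τ • m = 0 := by
      intro τ hτ
      refine Submodule.mul_induction_on hτ (fun x hx y hy => ?_) fun x y hx hy => by
        rw [add_smul, hx, hy, add_zero]
      have hy' := hsmul _ _ y hy m hm
      rw [mul_smul]
      refine Submodule.mul_induction_on hx (fun u _ v hv => ?_) fun u v hu hv => by
        rw [add_smul, hu, hv, add_zero]
      obtain ⟨c, rfl⟩ := Submodule.mem_span_singleton.1 hv
      rw [mul_smul, smul_assoc, hkill _ hy', smul_zero, smul_zero]
    exact hm0 (by simpa using hall 1 (hC δ hδ hδ0))
  refine (vdim_le_of_injective g hg).trans ?_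
  rw [Module.finrank_linearMap, sq, Nat.cast_mul]
  gcongr
  exact Submodule.finrank_mono (hmono (Nat.le_add_left a i))

/-- Bernstein's inequality is applied to `N' / N` with the filtration induced by `G`. The threshold
`j₀` is where `G` first is known to contain an element of `N'` outside `N`, so that the induced
filtration is nonzero from there on. -/
theorem exists_finrank_inf_add_le {w C : ℕ} {G : ℕ → Submodule K M}
    (hG : IsBernsteinModuleFil 𝒜 w G)
    (hC : ∀ i : ℕ, ∀ δ ∈ bernsteinFil 𝒜 w i, δ ≠ 0 →
      1 ∈ bernsteinFil 𝒜 w (C * i) * Submodule.span K {δ} * bernsteinFil 𝒜 w (C * i))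
    {N N' : Submodule (DiffOp K R) M} (hlt : N < N') :
    ∃ j₀ : ℕ, ∀ j ≥ j₀, ∀ i : ℕ, ∃ q : ℕ, vdim K (bernsteinFil 𝒜 w i) ≤ (q : ℝ≥0∞) ^ 2 ∧
      Module.finrank K ↥(G ((C + 1) * i + j) ⊓ N.restrictScalars K) + q ≤
        Module.finrank K ↥(G ((C + 1) * i + j) ⊓ N'.restrictScalars K) := by
  obtain ⟨hle, m, hm', hm⟩ := SetLike.lt_iff_le_and_exists.1 hlt
  obtain ⟨j₀, hj₀⟩ := hG.exhaustive m
  have hfin : ∀ (k : ℕ) (P : Submodule K M), FiniteDimensional K ↥(G k ⊓ P) := fun k P => by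
    have := hG.finite k
    exact Submodule.finiteDimensional_of_le inf_le_left
  let π : M →ₗ[K] M ⧸ N := N.mkQ.restrictScalars K
  refine ⟨j₀, fun j hj i => ?_⟩
  let H : ℕ → Submodule K (M ⧸ N) := fun k => (G k ⊓ N'.restrictScalars K).map π
  have hH := vdim_bernsteinFil_le 𝒜 (w := w) (C := C) (i := i) (j := j) (H := H)
    (fun a b hab => Submodule.map_mono (inf_le_inf_right _ (hG.mono hab)))
    (fun k => by have := hfin k (N'.restrictScalars K); infer_instance)
    (by
      rintro a b δ hδ _ ⟨x, ⟨hx, hx'⟩, rfl⟩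
      exact ⟨δ • x, ⟨hG.smul_mem a b δ hδ x hx, N'.smul_mem δ hx'⟩, by simp [π]⟩)
    (hC i)
    (by
      intro h0
      have h1 : π m ∈ H j := ⟨m, ⟨hG.mono hj hj₀, hm'⟩, rfl⟩
      rw [h0, Submodule.mem_bot] at h1
      exact hm (by simpa [π] using h1))
  -- The witness `q` is the dimension of the image of `G ⊓ N'` in `M / N`; the inequality is
  -- rank-nullity, as `G ⊓ N` embeds in the kernel.
  refine ⟨_, hH, ?_⟩
  have := hfin ((C + 1) * i + j) (N'.restrictScalars K)
  set X := G ((C + 1) * i + j) ⊓ N'.restrictScalars K with hX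
  have h1 := (π.domRestrict X).finrank_range_add_finrank_ker
  rw [LinearMap.range_domRestrict] at h1
  rw [add_comm, ← h1]
  refine Nat.add_le_add_left ?_ _
  have hmem : ∀ x : ↥(G ((C + 1) * i + j) ⊓ N.restrictScalars K), x.1 ∈ X :=
    fun x => ⟨x.2.1, hle x.2.2⟩
  let ι : ↥(G ((C + 1) * i + j) ⊓ N.restrictScalars K) →ₗ[K] LinearMap.ker (π.domRestrict X) :=
    { toFun := fun x => ⟨⟨x.1, hmem x⟩, by
        have := x.2.2
        simpa [π] using this⟩
      map_add' := fun x y => rfl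
      map_smul' := fun c x => rfl }
  refine LinearMap.finrank_le_finrank_of_injective (f := ι) fun x y hxy => ?_
  exact Subtype.ext (congrArg (fun z => z.1.1) hxy)

/-- A chain of `n` submodules forces the filtration to have, infinitely often, `n` times the
minimal dimension. -/
theorem exists_length_mul_le_finrank {w C : ℕ} {G : ℕ → Submodule K M}
    (hG : IsBernsteinModuleFil 𝒜 w G)
    (hC : ∀ i : ℕ, ∀ δ ∈ bernsteinFil 𝒜 w i, δ ≠ 0 →
      1 ∈ bernsteinFil 𝒜 w (C * i) * Submodule.span K {δ} * bernsteinFil 𝒜 w (C * i))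
    (s : LTSeries (Submodule (DiffOp K R) M)) :
    ∃ j : ℕ, ∀ (i : ℕ) (b : ℝ≥0∞), b ^ 2 ≤ vdim K (bernsteinFil 𝒜 w i) →
      s.length * b ≤ Module.finrank K (G ((C + 1) * i + j)) := by
  -- Only the shift `j` depends on the chain. The admissible `i` and `b` are governed by `ℬ` alone,
  -- so the same `i` serves all steps of the chain and the contributions can be added.
  have key : ∀ l : ℕ, ∀ hl : l < s.length + 1, ∃ j₀ : ℕ, ∀ j ≥ j₀, ∀ (i : ℕ) (b : ℝ≥0∞),
      b ^ 2 ≤ vdim K (bernsteinFil 𝒜 w i) → l * b ≤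
        Module.finrank K ↥(G ((C + 1) * i + j) ⊓ (s ⟨l, hl⟩).restrictScalars K) := by
    intro l
    induction l with
    | zero => intro hl; exact ⟨0, fun j _ i b _ => by simp⟩
    | succ l ih =>
      intro hl
      obtain ⟨j₁, hj₁⟩ := ih (by omega)
      obtain ⟨j₂, hj₂⟩ := exists_finrank_inf_add_le 𝒜 hG hC
        (s.strictMono (show (⟨l, by omega⟩ : Fin (s.length + 1)) < ⟨l + 1, hl⟩ by simp))
      refine ⟨max j₁ j₂, fun j hj i b hb => ?_⟩
      obtain ⟨q, hq, hle⟩ := hj₂ j (le_of_max_le_right hj) i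
      have hbq : b ≤ q := (ENNReal.pow_le_pow_left_iff two_ne_zero).1 (hb.trans hq)
      have h1 := hj₁ j (le_of_max_le_left hj) i b hb
      calc ((l + 1 : ℕ) : ℝ≥0∞) * b = l * b + b := by push_cast; ring
        _ ≤ _ := add_le_add h1 hbq
        _ ≤ _ := by exact_mod_cast hle
  obtain ⟨j, hj⟩ := key s.length (by omega)
  refine ⟨j, fun i b hb => (hj j le_rfl i b hb).trans ?_⟩
  have := hG.finite ((C + 1) * i + j)
  exact_mod_cast Submodule.finrank_mono inf_le_left

end BernsteinInequality

/-! ## The Hilbert function of a finitely generated graded algebra -/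

section NoetherGrowth

/-- Lying over lifts the bottom prime of a chain in `P`, and going up lifts the rest of the chain.
-/
theorem Algebra.IsIntegral.ringKrullDim_le_of_injective {P S : Type*} [CommRing P] [CommRing S]
    [Algebra P S] [Algebra.IsIntegral P S] [FaithfulSMul P S] :
    ringKrullDim P ≤ ringKrullDim S := by
  refine iSup_le fun l => ?_
  obtain ⟨Q, -, hQ, hQl⟩ := Ideal.exists_ideal_over_prime_of_isIntegral l.head.asIdeal (⊥ : Ideal S)
    (by simp [← RingHom.ker_eq_comap_bot, (RingHom.injective_iff_ker_eq_bot _).1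
      (FaithfulSMul.algebraMap_injective P S)])
  have : Q.LiesOver l.head.asIdeal := (Ideal.liesOver_iff _ _).2 hQl.symm
  obtain ⟨L, hL, -⟩ := Ideal.exists_ltSeries_of_hasGoingUp (S := S) l Q
  rw [← hL]
  exact Order.LTSeries.length_le_krullDim L

variable {K : Type*} [Field K] {R : Type*} [CommRing R] [Algebra K R]

/-- The span of the monomials in the `y i` with all exponents at most `N`. -/
def monomialSpan (K : Type*) [Field K] {R : Type*} [CommRing R] [Algebra K R] {s : ℕ}
    (y : Fin s → R) (N : ℕ) : Submodule K R :=
  Submodule.span K (Set.range fun a : Fin s → Fin (N + 1) => ∏ i, y i ^ (a i : ℕ))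

theorem finrank_monomialSpan_le {s : ℕ} (y : Fin s → R) (N : ℕ) :
    Module.finrank K (monomialSpan K y N) ≤ (N + 1) ^ s := by
  exact (finrank_range_le_card (R := K)
    (fun a : Fin s → Fin (N + 1) => ∏ i, y i ^ (a i : ℕ))).trans (by simp)

instance {s : ℕ} (y : Fin s → R) (N : ℕ) : FiniteDimensional K (monomialSpan K y N) :=
  FiniteDimensional.span_of_finite K (Set.finite_range _)

theorem prod_pow_mem_monomialSpan {s : ℕ} (y : Fin s → R) {N : ℕ} (a : Fin s → ℕ)
    (ha : ∀ i, a i ≤ N) : ∏ i, y i ^ a i ∈ monomialSpan K y N :=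
  Submodule.subset_span ⟨fun i => ⟨a i, Nat.lt_succ_of_le (ha i)⟩, rfl⟩

theorem monomialSpan_mono {s : ℕ} (y : Fin s → R) : Monotone (monomialSpan K y) := by
  intro M N h
  refine Submodule.span_le.2 ?_
  rintro _ ⟨a, rfl⟩
  exact prod_pow_mem_monomialSpan y _ fun i => (Nat.le_of_lt_succ (a i).2).trans h

theorem one_mem_monomialSpan {s : ℕ} (y : Fin s → R) (N : ℕ) : 1 ∈ monomialSpan K y N := by
  simpa using prod_pow_mem_monomialSpan (K := K) y (N := N) 0 (fun _ => Nat.zero_le _)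

theorem monomialSpan_mul_le {s : ℕ} (y : Fin s → R) (M N : ℕ) :
    monomialSpan K y M * monomialSpan K y N ≤ monomialSpan K y (M + N) := by
  rw [monomialSpan, monomialSpan, Submodule.span_mul_span, Submodule.span_le]
  rintro _ ⟨_, ⟨a, rfl⟩, _, ⟨b, rfl⟩, rfl⟩
  simp only [← Finset.prod_mul_distrib, ← pow_add]
  exact prod_pow_mem_monomialSpan y _ fun i => by have := (a i).2; have := (b i).2; omega

theorem exists_aeval_mem_monomialSpan {s : ℕ} (y : Fin s → R) (g : MvPolynomial (Fin s) K) :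
    ∃ N, MvPolynomial.aeval y g ∈ monomialSpan K y N := by
  induction g using MvPolynomial.induction_on with
  | C a =>
    refine ⟨0, ?_⟩
    rw [MvPolynomial.aeval_C, Algebra.algebraMap_eq_smul_one]
    exact Submodule.smul_mem _ _ (one_mem_monomialSpan y 0)
  | add g h hg hh =>
    obtain ⟨M, hM⟩ := hg
    obtain ⟨N, hN⟩ := hh
    rw [map_add]
    exact ⟨max M N, add_mem (monomialSpan_mono y (le_max_left M N) hM)
      (monomialSpan_mono y (le_max_right M N) hN)⟩
  | mul_X g i hg =>
    obtain ⟨M, hM⟩ := hg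
    rw [map_mul, MvPolynomial.aeval_X]
    refine ⟨M + 1, monomialSpan_mul_le y M 1 (Submodule.mul_mem_mul hM ?_)⟩
    classical
    have := prod_pow_mem_monomialSpan (K := K) y (N := 1) (Pi.single i 1) fun j => by
      rcases eq_or_ne j i with rfl | h <;> simp [*]
    simpa [Pi.single_apply, pow_ite, Finset.prod_ite_eq'] using this

theorem finiteDimensional_mul (V W : Submodule K R) [FiniteDimensional K V]
    [FiniteDimensional K W] : FiniteDimensional K ↥(V * W) :=
  Module.Finite.iff_fg.2 ((Module.Finite.iff_fg.1 ‹_›).mul (Module.Finite.iff_fg.1 ‹_›))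

/-- The powers of a finite-dimensional subspace of a finitely generated algebra grow at most like
the power of the exponent given by the Krull dimension. -/
theorem exists_finrank_pow_le [Algebra.FiniteType K R] {d : ℕ} (hd : ringKrullDim R = d)
    (U : Submodule K R) [FiniteDimensional K U] :
    ∃ A : ℕ, ∀ n : ℕ, Module.finrank K ↥(U ^ n) ≤ A * (n + 1) ^ d := by
  have hnt : Nontrivial R := by
    by_contra h
    rw [not_nontrivial_iff_subsingleton] at h
    rw [ringKrullDim_eq_bot_of_subsingleton] at hd
    exact absurd hd.symm (WithBot.coe_ne_bot (a := (d : ℕ∞)))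
  -- Noether normalization: `R` is finite over a polynomial ring in `s` variables. Integrality gives
  -- `s ≤ d`, so it is enough to count monomials in `s` variables.
  obtain ⟨s, φ, hinj, hfin⟩ := exists_finite_inj_algHom_of_fg K R
  algebraize [φ.toRingHom]
  have hmf : Module.Finite (MvPolynomial (Fin s) K) R := hfin
  have hfs : FaithfulSMul (MvPolynomial (Fin s) K) R :=
    (faithfulSMul_iff_algebraMap_injective _ _).2 hinj
  have hsd : s ≤ d := by
    have h1 := Algebra.IsIntegral.ringKrullDim_le_of_injective
      (P := MvPolynomial (Fin s) K) (S := R)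
    rw [MvPolynomial.ringKrullDim_of_isNoetherianRing, ringKrullDim_eq_zero_of_field, zero_add,
      Nat.card_fin, hd] at h1
    exact_mod_cast h1
  let y : Fin s → R := fun i => φ (MvPolynomial.X i)
  have hφ : ∀ g, φ g = MvPolynomial.aeval y g := fun g => by
    conv_lhs => rw [MvPolynomial.aeval_unique φ]
    rfl
  obtain ⟨T, hT⟩ := hmf.fg_top
  let W : Submodule K R := Submodule.span K (T : Set R)
  have hWfin : FiniteDimensional K W := FiniteDimensional.span_finset K T
  -- `W` is spanned by module generators over the polynomial ring, so its products with the
  -- `monomialSpan K y c` exhaust `R`.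
  have hex : ∀ x : R, ∃ c, x ∈ monomialSpan K y c * W := by
    intro x
    have hx : x ∈ Submodule.span (MvPolynomial (Fin s) K) (T : Set R) := hT ▸ Submodule.mem_top
    induction hx using Submodule.span_induction with
    | mem x hx =>
      have hxW : x ∈ W := Submodule.subset_span hx
      exact ⟨0, by simpa only [one_mul] using
        Submodule.mul_mem_mul (one_mem_monomialSpan (K := K) y 0) hxW⟩
    | zero => exact ⟨0, zero_mem _⟩
    | add x z _ _ hx hz =>
      obtain ⟨M, hM⟩ := hx
      obtain ⟨N, hN⟩ := hz
      exact ⟨max M N, add_mem (mul_le_mul_left (monomialSpan_mono y (le_max_left M N)) W hM)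
        (mul_le_mul_left (monomialSpan_mono y (le_max_right M N)) W hN)⟩
    | smul g x _ hx =>
      obtain ⟨M, hM⟩ := hx
      obtain ⟨N, hN⟩ := exists_aeval_mem_monomialSpan y g
      refine ⟨N + M, ?_⟩
      rw [Algebra.smul_def, show algebraMap _ R g = MvPolynomial.aeval y g from hφ g]
      refine mul_le_mul_left (monomialSpan_mul_le y N M) W ?_
      rw [mul_assoc]
      exact Submodule.mul_mem_mul hN hM
  have hle : ∀ V : Submodule K R, FiniteDimensional K V → ∃ c, V ≤ monomialSpan K y c * W := by
    intro V hV
    obtain ⟨B, hB⟩ := V.fg_iff_finiteDimensional.2 hV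
    choose c hc using hex
    refine ⟨B.sup c, ?_⟩
    rw [← hB, Submodule.span_le]
    intro b hb
    exact mul_le_mul_left (monomialSpan_mono y (Finset.le_sup hb)) W (hc b)
  -- Multiplying by `U` once costs `c` in the exponents, hence `U ^ n` costs `c * n`. The constant
  -- `c₁` brings in the factor `W`, since 1 need not lie in `W`.
  obtain ⟨c, hc⟩ := hle (U * W) (finiteDimensional_mul U W)
  obtain ⟨c₁, hc₁⟩ := hle 1 (by rw [Submodule.one_eq_span]; infer_instance)
  have hpow : ∀ n, U ^ n * W ≤ monomialSpan K y (c * n) * W := by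
    intro n
    induction n with
    | zero =>
      rw [pow_zero]
      exact mul_le_mul_left (Submodule.one_le.2 (one_mem_monomialSpan y _)) W
    | succ n ih =>
      calc U ^ (n + 1) * W = U * (U ^ n * W) := by rw [pow_succ']; rw [mul_assoc]
        _ ≤ U * (monomialSpan K y (c * n) * W) := mul_le_mul_right ih _
        _ = monomialSpan K y (c * n) * (U * W) := by
          rw [← mul_assoc, mul_comm U, mul_assoc]
        _ ≤ monomialSpan K y (c * n) * (monomialSpan K y c * W) := mul_le_mul_right hc _
        _ ≤ _ := by
          rw [← mul_assoc, Nat.mul_succ]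
          exact mul_le_mul_left (monomialSpan_mul_le y _ _) W
  refine ⟨(c₁ + c + 1) ^ s * Module.finrank K W, fun n => ?_⟩
  have h1 : U ^ n ≤ monomialSpan K y (c₁ + c * n) * W := by
    calc U ^ n = U ^ n * 1 := (mul_one _).symm
      _ ≤ U ^ n * (monomialSpan K y c₁ * W) := mul_le_mul_right hc₁ _
      _ = monomialSpan K y c₁ * (U ^ n * W) := by rw [← mul_assoc, mul_comm (U ^ n), mul_assoc]
      _ ≤ monomialSpan K y c₁ * (monomialSpan K y (c * n) * W) := mul_le_mul_right (hpow n) _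
      _ ≤ _ := by
        rw [← mul_assoc]
        exact mul_le_mul_left (monomialSpan_mul_le y _ _) W
  have := finiteDimensional_mul (monomialSpan K y (c₁ + c * n)) W
  calc Module.finrank K ↥(U ^ n) ≤ Module.finrank K ↥(monomialSpan K y (c₁ + c * n) * W) :=
        Submodule.finrank_mono h1
    _ ≤ Module.finrank K (monomialSpan K y (c₁ + c * n)) * Module.finrank K W := by
        -- A product of two subspaces is the image of their tensor product.
        rw [← Submodule.mulMap_range, ← Module.finrank_tensorProduct]
        exact LinearMap.finrank_range_le _
    _ ≤ (c₁ + c * n + 1) ^ s * Module.finrank K W :=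
        Nat.mul_le_mul_right _ (finrank_monomialSpan_le y _)
    _ ≤ ((c₁ + c + 1) * (n + 1)) ^ s * Module.finrank K W := by
        gcongr; nlinarith
    _ = ((c₁ + c + 1) ^ s * Module.finrank K W) * (n + 1) ^ s := by rw [mul_pow]; ring
    _ ≤ _ := by gcongr; omega

end NoetherGrowth

/-! ## The filtration of a graded algebra by degree -/

section DegreeFiltration

variable {K : Type*} [Field K] {R : Type*} [CommRing R] [Algebra K R]
variable (𝒜 : ℕ → Submodule K R)

/-- The elements of `R` of degree at most `n`. -/
def degreeLE (n : ℕ) : Submodule K R := ⨆ j ∈ Finset.range (n + 1), 𝒜 j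

variable {𝒜}

theorem le_degreeLE {j n : ℕ} (h : j ≤ n) : 𝒜 j ≤ degreeLE 𝒜 n :=
  le_iSup₂_of_le j (Finset.mem_range.2 (Nat.lt_succ_of_le h)) le_rfl

theorem degreeLE_le {n : ℕ} {V : Submodule K R} (h : ∀ j ≤ n, 𝒜 j ≤ V) : degreeLE 𝒜 n ≤ V :=
  iSup₂_le fun j hj => h j (Nat.le_of_lt_succ (Finset.mem_range.1 hj))

theorem degreeLE_mono : Monotone (degreeLE 𝒜) :=
  fun _ _ h => degreeLE_le fun _ hj => le_degreeLE (hj.trans h)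

variable [GradedAlgebra 𝒜]

theorem degreeLE_mul_le (m n : ℕ) : degreeLE 𝒜 m * degreeLE 𝒜 n ≤ degreeLE 𝒜 (m + n) := by
  rw [Submodule.mul_le]
  intro a ha b hb
  refine (degreeLE_le (V := (degreeLE 𝒜 (m + n)).comap (LinearMap.mulRight K b)) ?_) ha
  intro i hi x hx
  refine (degreeLE_le (V := (degreeLE 𝒜 (m + n)).comap (LinearMap.mulLeft K x)) ?_) hb
  intro j hj y hy
  exact le_degreeLE (add_le_add hi hj) (SetLike.mul_mem_graded hx hy)

theorem mul_mem_degreeLE {m n : ℕ} {a b : R} (ha : a ∈ degreeLE 𝒜 m) (hb : b ∈ degreeLE 𝒜 n) :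
    a * b ∈ degreeLE 𝒜 (m + n) :=
  degreeLE_mul_le m n (Submodule.mul_mem_mul ha hb)

theorem pow_mem_degreeLE {m : ℕ} {a : R} (ha : a ∈ degreeLE 𝒜 m) (k : ℕ) :
    a ^ k ∈ degreeLE 𝒜 (k * m) := by
  induction k with
  | zero => simpa using le_degreeLE (zero_le (a := 0)) (SetLike.one_mem_graded 𝒜)
  | succ k ih => rw [pow_succ, Nat.succ_mul]; exact mul_mem_degreeLE ih ha

theorem exists_mem_degreeLE (x : R) : ∃ n, x ∈ degreeLE 𝒜 n := by
  classical
  refine ⟨(DirectSum.decompose 𝒜 x).support.sup id, ?_⟩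
  have h : ∑ i ∈ (DirectSum.decompose 𝒜 x).support, (DirectSum.decompose 𝒜 x i : R) ∈
      degreeLE 𝒜 ((DirectSum.decompose 𝒜 x).support.sup id) := by
    refine sum_mem fun i hi => ?_
    have hi' : i ≤ (DirectSum.decompose 𝒜 x).support.sup id := Finset.le_sup (f := id) hi
    exact le_degreeLE hi' (DirectSum.decompose 𝒜 x i).2
  rwa [DirectSum.sum_support_decompose] at h

theorem decompose_mul_eq_sum (x y : R) (n : ℕ) :
    (DirectSum.decompose 𝒜 (x * y) n : R) =
      ∑ ij ∈ Finset.HasAntidiagonal.antidiagonal n,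
        (DirectSum.decompose 𝒜 x ij.1 : R) * DirectSum.decompose 𝒜 y ij.2 := by
  rw [DirectSum.decompose_mul, DirectSum.coe_mul_apply_eq_sum_antidiagonal]

/-- There is a finite-dimensional subspace whose `n`-th power contains all elements of degree at
most `n`. -/
theorem exists_degreeLE_le_pow [Algebra.FiniteType K R] (h𝒜 : 𝒜 0 = 1) :
    ∃ U : Submodule K R, FiniteDimensional K U ∧ ∀ n, degreeLE 𝒜 n ≤ U ^ n := by
  classical
  have : IsScalarTower K (𝒜 0) R := ⟨fun c a x => smul_mul_assoc c (a : R) x⟩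
  have : Algebra.FiniteType (𝒜 0) R := Algebra.FiniteType.of_restrictScalars_finiteType K (𝒜 0) R
  obtain ⟨S, hS, hdeg⟩ := GradedAlgebra.exists_finset_adjoin_eq_top_and_homogeneous_ne_zero 𝒜
  -- Including 1 makes the powers of `U` increase, so a generator of degree `m ≥ 1` lies in `U ≤ U ^
  -- m`, and components of degree `j ≤ n` lie in `U ^ n`.
  let U : Submodule K R := Submodule.span K (insert 1 (S : Set R))
  have h1 : 1 ≤ U := Submodule.one_le.2 (Submodule.subset_span (Set.mem_insert _ _))
  have hmono : Monotone (fun n => U ^ n) := fun m n h => pow_le_pow_right₀ h1 h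
  refine ⟨U, FiniteDimensional.span_of_finite K (S.finite_toSet.insert 1), fun n => ?_⟩
  have key : ∀ x : R, ∀ n, (DirectSum.decompose 𝒜 x n : R) ∈ U ^ n := by
    intro x
    have hx : x ∈ Algebra.adjoin (𝒜 0) (S : Set R) := hS ▸ Algebra.mem_top
    induction hx using Algebra.adjoin_induction with
    | mem x hx =>
      intro n
      obtain ⟨m, hm, hxm⟩ := hdeg x hx
      rcases eq_or_ne m n with rfl | hmn
      · rw [DirectSum.decompose_of_mem_same 𝒜 hxm]
        have hxU : x ∈ U ^ 1 := by
          rw [pow_one]; exact Submodule.subset_span (Set.mem_insert_of_mem _ hx)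
        exact hmono (Nat.one_le_iff_ne_zero.2 hm) hxU
      · rw [DirectSum.decompose_of_mem_ne 𝒜 hxm hmn]; exact zero_mem _
    | algebraMap a =>
      intro n
      have ha : algebraMap (𝒜 0) R a ∈ 𝒜 0 := a.2
      rcases eq_or_ne 0 n with rfl | hn
      · rw [DirectSum.decompose_of_mem_same 𝒜 ha, pow_zero, ← h𝒜]; exact ha
      · rw [DirectSum.decompose_of_mem_ne 𝒜 ha hn]; exact zero_mem _
    | add x y _ _ hx hy =>
      intro n
      rw [DirectSum.decompose_add, DirectSum.add_apply, Submodule.coe_add]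
      exact add_mem (hx n) (hy n)
    | mul x y _ _ hx hy =>
      intro n
      rw [decompose_mul_eq_sum]
      refine sum_mem fun ij hij => ?_
      rw [← Finset.HasAntidiagonal.mem_antidiagonal.1 hij, pow_add]
      exact Submodule.mul_mem_mul (hx _) (hy _)
  refine degreeLE_le fun j hj x hx => hmono hj ?_
  have := key x j
  rwa [DirectSum.decompose_of_mem_same 𝒜 hx] at this

/-- The Hilbert function of a finitely generated graded algebra of Krull dimension `d` grows at
most like `n ^ d`. -/
theorem exists_finrank_degreeLE_le [Algebra.FiniteType K R] (h𝒜 : 𝒜 0 = 1) {d : ℕ}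
    (hd : ringKrullDim R = d) :
    ∃ A : ℕ, ∀ n, FiniteDimensional K (degreeLE 𝒜 n) ∧
      Module.finrank K (degreeLE 𝒜 n) ≤ A * (n + 1) ^ d := by
  obtain ⟨U, hU, hle⟩ := exists_degreeLE_le_pow (𝒜 := 𝒜) h𝒜
  obtain ⟨A, hA⟩ := exists_finrank_pow_le hd U
  refine ⟨A, fun n => ?_⟩
  have hfin : FiniteDimensional K ↥(U ^ n) :=
    Module.Finite.iff_fg.2 ((Module.Finite.iff_fg.1 hU).pow n)
  exact ⟨Submodule.finiteDimensional_of_le (hle n), (Submodule.finrank_mono (hle n)).trans (hA n)⟩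

/-- `R` is generated by its homogeneous elements of positive degree less than `w`. -/
theorem adjoin_homogeneous_eq_top (h𝒜 : 𝒜 0 = 1) {w : ℕ}
    (hw : ∀ j, IsGeneratorDegree 𝒜 j → j < w) :
    Algebra.adjoin K {x : R | ∃ j < w, x ∈ 𝒜 j} = ⊤ := by
  classical
  set S := Algebra.adjoin K {x : R | ∃ j < w, x ∈ 𝒜 j} with hS
  have key : ∀ j, ∀ x ∈ 𝒜 j, x ∈ S := by
    intro j
    induction j using Nat.strong_induction_on with
    | _ j ih =>
    intro x hx
    by_cases hj : j < w
    · exact Algebra.subset_adjoin ⟨j, hj, hx⟩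
    rcases eq_or_ne j 0 with rfl | hj0
    · rw [h𝒜, Submodule.mem_one] at hx
      obtain ⟨c, rfl⟩ := hx
      exact S.algebraMap_mem c
    have hirr : x ∈ (HomogeneousIdeal.irrelevant 𝒜).toIdeal := by
      rw [HomogeneousIdeal.mem_iff, HomogeneousIdeal.mem_irrelevant_iff, GradedRing.proj_apply,
        DirectSum.decompose_of_mem_ne 𝒜 hx hj0]
    have hsq : x ∈ (HomogeneousIdeal.irrelevant 𝒜).toIdeal ^ 2 := by
      by_contra h
      exact hj (hw j ⟨x, hx, hirr, h⟩)
    -- The claim is restated for the component of degree `j`, which is additive on `𝔪²`, because the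
    -- summands of `x` there need not be homogeneous. In a product of two elements of `𝔪`, only
    -- factors of degree strictly between 0 and `j` contribute to it.
    rw [← DirectSum.decompose_of_mem_same 𝒜 hx]
    rw [sq] at hsq
    clear hx hirr
    refine Submodule.mul_induction_on hsq (fun a ha b hb => ?_) fun a b ha hb => ?_
    · rw [decompose_mul_eq_sum]
      refine sum_mem fun ij hij => ?_
      rw [Finset.HasAntidiagonal.mem_antidiagonal] at hij
      have h0 : ∀ c ∈ (HomogeneousIdeal.irrelevant 𝒜).toIdeal,
          (DirectSum.decompose 𝒜 c 0 : R) = 0 := fun c hc => by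
        rwa [HomogeneousIdeal.mem_iff, HomogeneousIdeal.mem_irrelevant_iff,
          GradedRing.proj_apply] at hc
      rcases eq_or_ne ij.1 0 with h | h
      · rw [h, h0 a ha, zero_mul]; exact zero_mem _
      rcases eq_or_ne ij.2 0 with h' | h'
      · rw [h', h0 b hb, mul_zero]; exact zero_mem _
      exact mul_mem (ih _ (by omega) _ (SetLike.coe_mem _)) (ih _ (by omega) _ (SetLike.coe_mem _))
    · rw [DirectSum.decompose_add, DirectSum.add_apply, Submodule.coe_add]
      exact add_mem ha hb
  refine eq_top_iff.2 fun x _ => ?_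
  rw [← DirectSum.sum_support_decompose 𝒜 x]
  exact sum_mem fun i _ => key i _ (SetLike.coe_mem _)

end DegreeFiltration

/-! ## Homogeneous operators and the order filtration -/

section OrderBound

variable {K : Type*} [Field K] {R : Type*} [CommRing R] [Algebra K R]
variable {𝒜 : ℕ → Submodule K R}

theorem commMul_apply (r : R) (δ : Module.End K R) (x : R) :
    commMul K r δ x = δ (r * x) - r * δ x := by
  simp [commMul]

/-- An operator commuting with multiplication by the generators of `R` is `R`-linear. -/
theorem mem_diffOpOrd_zero_of_adjoin {S : Set R} (hS : Algebra.adjoin K S = ⊤)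
    {δ : Module.End K R} (h : ∀ s ∈ S, commMul K s δ = 0) : δ ∈ diffOpOrd K R 0 := by
  intro r
  have hr : r ∈ Algebra.adjoin K S := hS ▸ Algebra.mem_top
  induction hr using Algebra.adjoin_induction with
  | mem s hs =>
    intro x
    have := LinearMap.congr_fun (h s hs) x
    rwa [commMul_apply, LinearMap.zero_apply, sub_eq_zero] at this
  | algebraMap c => intro x; rw [← Algebra.smul_def, map_smul, Algebra.smul_def]
  | add a b _ _ ha hb => intro x; rw [add_mul, map_add, ha, hb, add_mul]
  | mul a b _ _ ha hb => intro x; rw [mul_assoc, ha, hb, mul_assoc]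

theorem IsHomogeneousOp.map_degreeLE {d : ℤ} {δ : Module.End K R} (h : IsHomogeneousOp 𝒜 d δ)
    {i : ℕ} (hd : d ≤ i) (m : ℕ) : ∀ x ∈ degreeLE 𝒜 m, δ x ∈ degreeLE 𝒜 (m + i) := by
  intro x hx
  refine (degreeLE_le (V := (degreeLE 𝒜 (m + i)).comap δ) ?_) hx
  intro j hj y hy
  rw [Submodule.mem_comap]
  rcases lt_or_ge ((j : ℤ) + d) 0 with hlt | hge
  · rw [(h j y hy).2 hlt]; exact zero_mem _
  · obtain ⟨l, hl⟩ := Int.eq_ofNat_of_zero_le hge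
    exact le_degreeLE (by omega) ((h j y hy).1 l hl.symm)

variable [GradedAlgebra 𝒜]

theorem IsHomogeneousOp.commMul {d : ℤ} {δ : Module.End K R} (h : IsHomogeneousOp 𝒜 d δ) {i : ℕ}
    {r : R} (hr : r ∈ 𝒜 i) : IsHomogeneousOp 𝒜 (d + i) (commMul K r δ) := by
  intro j x hx
  have hrx : r * x ∈ 𝒜 (i + j) := SetLike.mul_mem_graded hr hx
  rw [commMul_apply]
  refine ⟨fun k hk => sub_mem ((h _ _ hrx).1 k (by push_cast; omega)) ?_, fun hneg => ?_⟩
  · rcases lt_or_ge ((j : ℤ) + d) 0 with hlt | hge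
    · rw [(h j x hx).2 hlt, mul_zero]; exact zero_mem _
    · obtain ⟨l, hl⟩ := Int.eq_ofNat_of_zero_le hge
      have hkl : k = i + l := by omega
      rw [hkl]
      exact SetLike.mul_mem_graded hr ((h j x hx).1 l hl.symm)
  · rw [(h _ _ hrx).2 (by push_cast; omega), (h j x hx).2 (by omega), mul_zero, sub_zero]

/-- An `R`-linear operator is multiplication by its value at 1, and here that value would have
negative degree. -/
theorem eq_zero_of_mem_diffOpOrd_zero {d : ℤ} {δ : Module.End K R} (h : IsHomogeneousOp 𝒜 d δ)
    (h0 : δ ∈ diffOpOrd K R 0) (hd : d < 0) : δ = 0 := by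
  ext x
  have h1 : δ 1 = 0 := (h 0 1 (SetLike.one_mem_graded 𝒜)).2 (by simpa using hd)
  simpa [h1] using mem_diffOpOrd_zero.1 h0 x 1

/-- A nonzero homogeneous operator of order `n` has degree at least `-n (w - 1)`. -/
theorem IsHomogeneousOp.eq_zero_of_degree_lt {w : ℕ}
    (hgen : Algebra.adjoin K {x : R | ∃ j < w + 1, x ∈ 𝒜 j} = ⊤) {n : ℕ} :
    ∀ {d : ℤ} {δ : Module.End K R}, IsHomogeneousOp 𝒜 d δ → δ ∈ diffOpOrd K R n →
      d < -(n * w : ℤ) → δ = 0 := by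
  induction n with
  | zero => intro d δ h hn hd; exact eq_zero_of_mem_diffOpOrd_zero h hn (by simpa using hd)
  | succ n ih =>
    intro d δ h hn hd
    have hnw : (0 : ℤ) ≤ n * w := by positivity
    push_cast at hd
    refine eq_zero_of_mem_diffOpOrd_zero h (mem_diffOpOrd_zero_of_adjoin hgen ?_) (by nlinarith)
    -- The commutator with a generator of degree `j ≤ w` has order one less and degree `d + j < -n
    -- w`, so it vanishes by induction. Thus `δ` is `R`-linear of negative degree.
    rintro s ⟨j, hj, hs⟩
    have hj' : (j : ℤ) ≤ w := by omega
    exact ih (h.commMul hs) (hn s) (by nlinarith)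

/-- An operator in the `i`-th piece of the Bernstein filtration has order at most `i` and raises
degrees by at most `i`. -/
theorem order_and_degree_of_mem_bernsteinFil (h𝒜 : 𝒜 0 = 1) {w : ℕ}
    (hw : ∀ j, IsGeneratorDegree 𝒜 j → j < w) {i : ℕ} {δ : DiffOp K R}
    (hδ : δ ∈ bernsteinFil 𝒜 w i) :
    δ.toEnd ∈ diffOpOrd K R i ∧ ∀ m, ∀ x ∈ degreeLE 𝒜 m, δ.toEnd x ∈ degreeLE 𝒜 (m + i) := by
  have hgen := adjoin_homogeneous_eq_top h𝒜 hw
  induction hδ using Submodule.span_induction with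
  | mem δ hδ =>
    obtain ⟨d, n, hd, hn, hi⟩ := hδ
    have hwn : (0 : ℤ) ≤ w * n := by positivity
    refine ⟨?_, hd.map_degreeLE (by omega)⟩
    rcases w with _ | w
    -- For `w = 0` there are no generators, so `R` is the image of `K` and every operator has order
    -- 0.
    · exact diffOpOrd_mono (Nat.zero_le i) (mem_diffOpOrd_zero_of_adjoin hgen (by simp))
    · by_cases hlt : d < -(n * w : ℤ)
      · rw [hd.eq_zero_of_degree_lt hgen hn hlt]; exact zero_mem _
      · refine diffOpOrd_mono ?_ hn
        push_cast at hi
        -- With slope `w + 1`, adding `d ≥ -n w` to `d + (w + 1) n ≤ i` leaves `n ≤ i`.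
        have : (n : ℤ) ≤ i := by nlinarith
        exact_mod_cast this
  | zero => simp
  | add δ ε _ _ hδ hε =>
    rw [map_add]
    exact ⟨add_mem hδ.1 hε.1, fun m x hx => add_mem (hδ.2 m x hx) (hε.2 m x hx)⟩
  | smul c δ _ hδ =>
    rw [map_smul]
    exact ⟨Submodule.smul_mem _ c hδ.1, fun m x hx => Submodule.smul_mem _ c (hδ.2 m x hx)⟩

/-- An operator of order `n` maps `f ^ (n + b) R` to `f ^ b R`, with control of degrees. -/
theorem exists_map_pow_mul_eq {f : R} {F : ℕ} (hf : f ∈ degreeLE 𝒜 F) {n : ℕ} :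
    ∀ {i : ℕ} {δ : Module.End K R}, δ ∈ diffOpOrd K R n →
      (∀ m, ∀ x ∈ degreeLE 𝒜 m, δ x ∈ degreeLE 𝒜 (m + i)) →
      ∀ (b m : ℕ), ∀ r ∈ degreeLE 𝒜 m, ∃ h ∈ degreeLE 𝒜 (m + i + n * F),
        δ (f ^ (n + b) * r) = f ^ b * h := by
  induction n with
  | zero =>
    intro i δ h0 hδ b m r hr
    exact ⟨δ r, by simpa using hδ m r hr, by rw [zero_add, mem_diffOpOrd_zero.1 h0]⟩
  | succ n ih =>
    intro i δ hn hδ b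
    induction b with
    | zero =>
      intro m r hr
      refine ⟨_, ?_, by rw [pow_zero, one_mul]⟩
      have := hδ _ _ (mul_mem_degreeLE (pow_mem_degreeLE hf (n + 1 + 0)) hr)
      convert this using 2
      ring
    | succ b ihb =>
      intro m r hr
      obtain ⟨h, hh, he⟩ := ihb m r hr
      have hcomm : ∀ m, ∀ x ∈ degreeLE 𝒜 m, commMul K f δ x ∈ degreeLE 𝒜 (m + (i + F)) := by
        intro m x hx
        rw [commMul_apply]
        refine sub_mem ?_ ?_
        · convert hδ _ _ (mul_mem_degreeLE hf hx) using 2; ring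
        · convert mul_mem_degreeLE hf (hδ _ _ hx) using 2; ring
      -- With `y = f ^ (n + 1 + b) * r`, one has `δ (f y) = f δ(y) + [δ, f](y)`. The induction on
      -- `b` gives `f ^ b` in `δ(y)`; the commutator has order `n`, so the induction on `n` leaves
      -- `f ^ (b + 1)` in the other term. Its degree shift `i + F` accounts for the extra `F` in the
      -- bound.
      obtain ⟨h', hh', he'⟩ := ih (hn f) hcomm (b + 1) m r hr
      refine ⟨h + h', add_mem hh (by convert hh' using 2; ring), ?_⟩
      rw [commMul_apply, ← mul_assoc, ← pow_succ', sub_eq_iff_eq_add] at he'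
      rw [show n + 1 + (b + 1) = n + (b + 1) + 1 by ring, he',
        show n + (b + 1) = n + 1 + b by ring, he]
      ring

end OrderBound

/-! ## Modules with a filtration of minimal growth -/

section MinimalGrowth

open Filter

variable {K : Type*} [Field K] {R : Type*} [CommRing R] [Algebra K R] {𝒜 : ℕ → Submodule K R}
variable {M : Type*} [AddCommGroup M] [Module K M] [Module (DiffOp K R) M]
  [IsScalarTower K (DiffOp K R) M]

/-- Over a Bernstein algebra of dimension `d`, there is a constant `c > 0` such that a chain of `n`
submodules makes every filtration infinitely often larger than `n c k ^ d`. -/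
theorem IsBernsteinAlgebra.exists_frequently_le_finrank {w : ℕ} (hR : IsBernsteinAlgebra 𝒜 w)
    {d : ℕ} (hd : ringKrullDim R = d) {G : ℕ → Submodule K M} (hG : IsBernsteinModuleFil 𝒜 w G) :
    ∃ c : ℝ≥0∞, c ≠ 0 ∧ ∀ s : LTSeries (Submodule (DiffOp K R) M), ∃ᶠ k : ℕ in atTop,
      s.length * c * (k : ℝ≥0∞) ^ d ≤ Module.finrank K (G k) := by
  obtain ⟨C, -, hC⟩ := hR.linearly_simple
  obtain ⟨d', hd', hgrowth⟩ := hR.dim_eq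
  obtain rfl : d = d' := by rw [hd] at hd'; exact_mod_cast hd'
  obtain ⟨c, hc, hfr⟩ := frequently_of_growthMult_pos hgrowth hR.mult_pos
  -- Once `i ≥ j`, the index `k = (C + 1) i + j` is at most `(C + 2) i`, which turns `c i^d` into a
  -- multiple of `k^d` with a constant independent of the chain.
  refine ⟨c / ((C + 2 : ℕ) : ℝ≥0∞) ^ d, ?_, fun s => ?_⟩
  · exact ENNReal.div_ne_zero.2 ⟨hc, ENNReal.pow_ne_top (ENNReal.natCast_ne_top _)⟩
  obtain ⟨j, hj⟩ := exists_length_mul_le_finrank 𝒜 hG hC s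
  have htend : Tendsto (fun i : ℕ => (C + 1) * i + j) atTop atTop :=
    tendsto_atTop_mono (fun i => show i ≤ _ by nlinarith) tendsto_id
  refine htend.frequently ((hfr.and_eventually (eventually_ge_atTop j)).mono ?_)
  rintro i ⟨hi, hij⟩
  refine le_trans ?_ (hj i _ hi)
  rw [mul_assoc]
  refine mul_le_mul_right ?_ _
  have hle : (((C + 1) * i + j : ℕ) : ℝ≥0∞) ≤ ((C + 2 : ℕ) : ℝ≥0∞) * i := by
    exact_mod_cast (by nlinarith : (C + 1) * i + j ≤ (C + 2) * i)
  calc c / ((C + 2 : ℕ) : ℝ≥0∞) ^ d * (((C + 1) * i + j : ℕ) : ℝ≥0∞) ^ d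
      ≤ c / ((C + 2 : ℕ) : ℝ≥0∞) ^ d * (((C + 2 : ℕ) : ℝ≥0∞) * i) ^ d := by gcongr
    _ = c / ((C + 2 : ℕ) : ℝ≥0∞) ^ d * ((C + 2 : ℕ) : ℝ≥0∞) ^ d * (i : ℝ≥0∞) ^ d := by
        rw [mul_pow, mul_assoc]
    _ = c * (i : ℝ≥0∞) ^ d := by
        rw [ENNReal.div_mul_cancel (pow_ne_zero _ (by simp))
          (ENNReal.pow_ne_top (ENNReal.natCast_ne_top _))]

/-- A module with a filtration of dimension at most `dim R` and finite multiplicity has finite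
length. -/
theorem IsBernsteinAlgebra.isFiniteLength {w : ℕ} (hR : IsBernsteinAlgebra 𝒜 w)
    {d : ℕ} (hd : ringKrullDim R = d) {G : ℕ → Submodule K M} (hG : IsBernsteinModuleFil 𝒜 w G)
    {A : ℕ} (hA : ∀ k ≥ 1, Module.finrank K (G k) ≤ A * k ^ d) :
    IsFiniteLength (DiffOp K R) M := by
  obtain ⟨c, hc, hlow⟩ := hR.exists_frequently_le_finrank hd hG
  have hbound : ∀ s : LTSeries (Submodule (DiffOp K R) M), (s.length : ℝ≥0∞) ≤ A / c := by
    intro s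
    obtain ⟨k, hk, hk1⟩ := ((hlow s).and_eventually (eventually_ge_atTop 1)).exists
    have hk0 : (k : ℝ≥0∞) ≠ 0 := by exact_mod_cast (by omega : k ≠ 0)
    have h1 : s.length * c * (k : ℝ≥0∞) ^ d ≤ A * (k : ℝ≥0∞) ^ d :=
      hk.trans (by exact_mod_cast hA k hk1)
    rw [ENNReal.mul_le_mul_iff_left (pow_ne_zero _ hk0)
      (ENNReal.pow_ne_top (ENNReal.natCast_ne_top _))] at h1
    exact ENNReal.le_div_iff_mul_le (Or.inl hc) (Or.inr (ENNReal.natCast_ne_top A)) |>.2 h1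
  obtain ⟨B, hB⟩ := ENNReal.exists_nat_gt (ENNReal.div_ne_top (ENNReal.natCast_ne_top A) hc)
  rw [← Module.length_ne_top_iff, Module.length_ne_top_iff_finiteDimensionalOrder]
  by_contra hinf
  rw [not_finiteDimensionalOrder_iff] at hinf
  have h2 := hbound (LTSeries.withLength _ B)
  rw [LTSeries.length_withLength] at h2
  exact absurd hB (not_lt.2 h2)

/-- A nonzero module with a filtration of dimension at most `dim R` and finite multiplicity is
holonomic. -/
theorem IsBernsteinAlgebra.isHolonomic [Nontrivial M] {w : ℕ} (hR : IsBernsteinAlgebra 𝒜 w)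
    {d : ℕ} (hd : ringKrullDim R = d) {G : ℕ → Submodule K M} (hG : IsBernsteinModuleFil 𝒜 w G)
    {A : ℕ} (hA : ∀ k ≥ 1, Module.finrank K (G k) ≤ A * k ^ d) :
    IsHolonomic 𝒜 M w := by
  have hlen := isFiniteLength_iff_isNoetherian_isArtinian.1 (hR.isFiniteLength hd hG hA)
  have hnoeth := hlen.1
  obtain ⟨c, hc, hlow⟩ := hR.exists_frequently_le_finrank hd hG
  have hvd : ∀ k, vdim K (G k) = Module.finrank K (G k) := fun k => by
    have := hG.finite k
    exact vdim_eq_finrank _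
  have hup : ∀ᶠ k : ℕ in atTop, vdim K (G k) ≤ (A : ℝ≥0∞) * (k : ℝ≥0∞) ^ d := by
    filter_upwards [eventually_ge_atTop 1] with k hk
    rw [hvd]
    exact_mod_cast hA k hk
  -- The one-step chain `⊥ < ⊤` already gives the lower bound `c k^d` infinitely often, so the
  -- exponent cannot drop below `d`.
  let s : LTSeries (Submodule (DiffOp K R) M) :=
    (RelSeries.singleton _ ⊤).cons ⊥ (bot_lt_top : (⊥ : Submodule (DiffOp K R) M) < ⊤)
  have hdim : growthDim (fun k => vdim K (G k)) = d := by
    refine le_antisymm (growthDim_le_of_le_pow (ENNReal.natCast_ne_top A) hup)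
      (le_growthDim_of_frequently hc ((hlow s).mono fun k hk => ?_))
    have hs : s.length = 1 := rfl
    rwa [hvd, ← one_mul c, ← Nat.cast_one, ← hs]
  exact ⟨inferInstance, inferInstance, G, hG, ⟨d, hd, hdim⟩,
    growthMult_lt_top_of_le_pow (ENNReal.natCast_ne_top A) hdim hup⟩

end MinimalGrowth

/-! ## The filtration of `R_f f^α` by pole order -/

section PoleFiltration

variable {p : ℕ} [hp : Fact p.Prime] {K : Type*} [Field K] {R : Type*} [CommRing R] [Algebra K R]

/-- The map `r ↦ (r / f ^ N) f^α`. -/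
noncomputable def RfAlpha.frac (K : Type*) [Field K] {R : Type*} [CommRing R] [Algebra K R] (f : R)
    (α : ℤ_[p]) (N : ℕ) : R →ₗ[K] RfAlpha f α where
  toFun r := awayFrac f r N
  map_add' r s := awayFrac_add f r s N
  map_smul' c r := awayFrac_smul c f r N

theorem RfAlpha.frac_pow_mul (f : R) (α : ℤ_[p]) (r : R) (N k : ℕ) :
    RfAlpha.frac K f α (k + N) (f ^ k * r) = RfAlpha.frac K f α N r :=
  awayFrac_pow_mul f r N k

variable (𝒜 : ℕ → Submodule K R)

/-- The filtration of `R_f f^α` by the subspaces `f^{-i} R_{≤ (F + 1) i} f^α`. -/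
noncomputable def poleFil (f : R) (α : ℤ_[p]) (F i : ℕ) : Submodule K (RfAlpha f α) :=
  (degreeLE 𝒜 ((F + 1) * i)).map (RfAlpha.frac K f α i)

variable {𝒜}

theorem frac_mem_poleFil {f : R} {α : ℤ_[p]} {F i m : ℕ} (hm : m ≤ (F + 1) * i) {r : R}
    (hr : r ∈ degreeLE 𝒜 m) : RfAlpha.frac K f α i r ∈ poleFil 𝒜 f α F i :=
  Submodule.mem_map_of_mem (degreeLE_mono hm hr)

variable [CharP R p] [GradedAlgebra 𝒜]

/-- The slope `F + 1` is exact here: an element of `ℬ^i` raises the degree of the numerator by `i`,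
and `i` commutators with `f` add `i F`. -/
theorem smul_mem_poleFil (h𝒜 : 𝒜 0 = 1) {w : ℕ} (hw : ∀ j, IsGeneratorDegree 𝒜 j → j < w)
    {f : R} (α : ℤ_[p]) {F : ℕ} (hf : f ∈ degreeLE 𝒜 F) (i j : ℕ) (δ : DiffOp K R)
    (hδ : δ ∈ bernsteinFil 𝒜 w i) (g : RfAlpha f α) (hg : g ∈ poleFil 𝒜 f α F j) :
    δ • g ∈ poleFil 𝒜 f α F (i + j) := by
  obtain ⟨r, hr, rfl⟩ := hg
  obtain ⟨hord, hdeg⟩ := order_and_degree_of_mem_bernsteinFil h𝒜 hw hδ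
  obtain ⟨e, he⟩ := exists_hasLevel p δ.toEnd_mem
  -- The action is computed over the denominator `f ^ N`, where `N = i + j + b` approximates `α`.
  -- The numerator becomes `f ^ (i + b) * r`; its image is divisible by `f ^ b`, and cancelling
  -- leaves the denominator `f ^ (i + j)`.
  obtain ⟨N, hN, hNα⟩ := exists_large_approx α e (i + j)
  obtain ⟨b, rfl⟩ := Nat.exists_eq_add_of_le hN
  obtain ⟨h, hh, heq⟩ := exists_map_pow_mul_eq hf hord hdeg b _ r hr
  have h1 : δ • RfAlpha.frac K f α j r = RfAlpha.frac K f α (i + j) h := by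
    rw [← RfAlpha.frac_pow_mul f α r j (i + b), ← RfAlpha.frac_pow_mul f α h (i + j) b, ← heq,
      show i + b + j = i + j + b by ring, show b + (i + j) = i + j + b by ring]
    exact upsilon_awayFrac f α δ he hNα _
  rw [h1]
  exact frac_mem_poleFil (by apply le_of_eq; ring) hh

theorem isBernsteinModuleFil_poleFil (h𝒜 : 𝒜 0 = 1) {w : ℕ}
    (hw : ∀ j, IsGeneratorDegree 𝒜 j → j < w) (hfin : ∀ n, FiniteDimensional K (degreeLE 𝒜 n))
    {f : R} (α : ℤ_[p]) {F : ℕ} (hf : f ∈ degreeLE 𝒜 F) :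
    IsBernsteinModuleFil 𝒜 w (poleFil 𝒜 f α F) where
  mono := by
    intro i j hij
    obtain ⟨k, rfl⟩ := Nat.exists_eq_add_of_le' hij
    rintro _ ⟨r, hr, rfl⟩
    rw [← RfAlpha.frac_pow_mul f α r i k]
    exact frac_mem_poleFil (by nlinarith) (mul_mem_degreeLE (pow_mem_degreeLE hf k) hr)
  finite i := by
    have := hfin ((F + 1) * i)
    rw [poleFil]
    infer_instance
  exhaustive g := by
    obtain ⟨m, hm⟩ := exists_awayFrac f g
    obtain ⟨r, hr⟩ := hm m le_rfl
    obtain ⟨n, hn⟩ := exists_mem_degreeLE (𝒜 := 𝒜) r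
    -- Enlarging the denominator by one factor `f` adds at most `F` to the degree of the numerator
    -- and `F + 1` to the degree allowed. The gain of 1 per factor, taken `n` times, absorbs the
    -- degree of `r`.
    refine ⟨n + m, ?_⟩
    have hg : g = RfAlpha.frac K f α m r := hr
    rw [hg, ← RfAlpha.frac_pow_mul f α r m n]
    exact frac_mem_poleFil (by nlinarith) (mul_mem_degreeLE (pow_mem_degreeLE hf n) hn)
  smul_mem := smul_mem_poleFil h𝒜 hw α hf

end PoleFiltration

theorem mainTheorem12 {p : ℕ} [Fact p.Prime] {K : Type*} [Field K] {R : Type*} [CommRing R]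
    [Algebra K R] [CharP R p] [Algebra.FiniteType K R]
    (𝒜 : ℕ → Submodule K R) [GradedAlgebra 𝒜] (h𝒜 : 𝒜 0 = 1)
    (w : ℕ) (hw : ∀ j, IsGeneratorDegree 𝒜 j → j < w)
    (hR : IsBernsteinAlgebra 𝒜 w)
    (f : R) (hf : f ≠ 0) (α : ℤ_[p]) :
    (¬ IsNilpotent f → IsHolonomic 𝒜 (RfAlpha f α) w) ∧
      IsFiniteLength (DiffOp K R) (RfAlpha f α) := by
  obtain ⟨d, hd, -⟩ := hR.dim_eq
  obtain ⟨A, hA⟩ := exists_finrank_degreeLE_le h𝒜 hd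
  obtain ⟨F, hF⟩ := exists_mem_degreeLE (𝒜 := 𝒜) f
  have hG := isBernsteinModuleFil_poleFil h𝒜 hw (fun n => (hA n).1) α hF
  have hbound : ∀ k ≥ 1, Module.finrank K (poleFil 𝒜 f α F k) ≤ A * (F + 2) ^ d * k ^ d := by
    intro k hk
    have := (hA ((F + 1) * k)).1
    calc Module.finrank K (poleFil 𝒜 f α F k) ≤ Module.finrank K (degreeLE 𝒜 ((F + 1) * k)) :=
          Submodule.finrank_map_le _ _
      _ ≤ A * ((F + 1) * k + 1) ^ d := (hA _).2
      -- The additive 1 is absorbed using `k ≥ 1`.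
      _ ≤ A * ((F + 2) * k) ^ d := by gcongr; nlinarith
      _ = A * (F + 2) ^ d * k ^ d := by rw [mul_pow]; ring
  -- The bound on chains also covers the zero module, so finite length needs no case distinction;
  -- non-nilpotency serves only to make `R_f` nonzero.
  refine ⟨fun hnil => ?_, hR.isFiniteLength hd hG hbound⟩
  have : Nontrivial (RfAlpha f α) := by
    by_contra h
    rw [not_nontrivial_iff_subsingleton] at h
    have hsub : Subsingleton (Localization.Away f) := h
    obtain ⟨n, hn⟩ := (IsLocalization.subsingleton_iff (M := Submonoid.powers f) (S := Localization.Away f)).1 hsub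
    exact hnil ⟨n, hn⟩
  exact hR.isHolonomic hd hG hbound
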